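/- Let $\Omega=(a,b)$ be a finite interval with $a<b$, let $0<\alpha<1$ and $1<p<\infty$. The upper signs and the lower signs below give two separate statements. \emph{Definitions.} For $0<\beta<1$ let $${}^{-}I^{\beta}f(x)=\frac1{\Gamma(\beta)}\int_a^x (x-y)^{\beta-1}f(y)\,dy,\qquad {}^{+}I^{\beta}f(x)=\frac1{\Gamma(\beta)}\int_x^b (y-x)^{\beta-1}f(y)\,dy .$$ For $\varphi\in C_0^\infty(\Omega)$ let ${}^{-}D^{\alpha}\varphi={}^{-}I^{1-\alpha}\varphi'$ and ${}^{+}D^{\alpha}\varphi=-\,{}^{+}I^{1-\alpha}\varphi'$. For $u\in L^1(\Omega)$, the weak derivative ${}^{\pm}\mathcal D^{\alpha}u$ is the function $g\in L^1_{loc}(\Omega)$ (if one exists; it is then unique almost everywhere) with $\int_\Omega g\varphi\,dx=\int_\Omega u\;{}^{\mp}D^{\alpha}\varphi\,dx$ for all $\varphi\in C_0^\infty(\Omega)$. Let ${}^{\pm}W^{\alpha,p}=\{u\in L^p(\Omega):{}^{\pm}\mathcal D^\alpha u\in L^p(\Omega)\}$ and $${}^{\pm}E^\alpha_p(u)=\frac1p\int_\Omega|{}^{\pm}\mathcal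 D^\alpha u|^p\,dx .$$ The trace ${}^{-}Tf$ (respectively ${}^{+}Tf$) is the limit at $b$ (respectively at $a$), taken from inside $\Omega$, of a function that agrees with $f$ almost everywhere in $\Omega$, whenever such a finite limit exists. Let ${}^{\pm}\mathring W^{\alpha,p}$ be the set of $v\in{}^{\pm}W^{\alpha,p}$ with ${}^{\mp}T\,{}^{\pm}I^{1-\alpha}v=0$. For $u\in {}^{\pm}W^{\alpha,p}$ put $w_u=|{}^{\pm}\mathcal D^\alpha u|^{p-2}\,{}^{\pm}\mathcal D^\alpha u$ and $${}^{\pm}\Delta^\alpha_pu={}^{\mp}\mathcal D^\alpha w_u,\qquad {}^{\pm}\mathcal N^\alpha_pu={}^{\pm}T\,{}^{\mp}I^{1-\alpha}w_u,$$ whenever these exist. \emph{Theorem.} (a) (Natural boundary condition.) If $u\in{}^{\pm}W^{\alpha,p}$ minimizes ${}^{\pm}E^\alpha_p$ over the whole space ${}^{\pm}W^{\alpha,p}$, then ${}^{\pm}\mathcal N^\alpha_pu$ exists and ${}^{\pm}\mathcal N^\alpha_pu=0$. (b) (Fractional Green's identity.) Let $u\in{}^{\pm}W^{\alpha,p}$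 be such that ${}^{\pm}\Delta^\alpha_pu$ exists and belongs to $L^1(\Omega)$, and suppose that at least one of the following holds: (i) $v\in C^\infty(\overline\Omega)$; (ii) $\alpha p>1$ and $v\in{}^{\pm}\mathring W^{\alpha,p}$; (iii) ${}^{\pm}\Delta^\alpha_pu\in L^{p/(p-1)}(\Omega)$, $v\in{}^{\pm}\mathring W^{\alpha,p}$ and ${}^{\pm}Tv$ exists. Then ${}^{\pm}\mathcal D^\alpha v$, ${}^{\pm}\mathcal N^\alpha_pu$ and ${}^{\pm}Tv$ exist, both integrands below are integrable, and $$\int_\Omega|{}^{\pm}\mathcal D^\alpha u|^{p-2}\,{}^{\pm}\mathcal D^\alpha u\;{}^{\pm}\mathcal D^\alpha v\,dx=\int_\Omega{}^{\pm}\Delta^\alpha_pu\;v\,dx+{}^{\pm}\mathcal N^\alpha_pu\;{}^{\pm}Tv .$$ -/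

import Mathlib

open MeasureTheory Set Filter Topology
open scoped ContDiff

namespace FracCalc

/-- The two directions: `left` is the superscript `-`, `right` is the superscript `+`. -/
inductive Side where
  | left : Side
  | right : Side

/-- The opposite direction, `± ↦ ∓`. -/
def Side.opp : Side → Side
  | .left => .right
  | .right => .left

/-- Lebesgue measure on `Ω = (a, b)`. -/
noncomputable def vol (a b : ℝ) : Measure ℝ := volume.restrict (Ioo a b)

/-- Left and right Riemann-Liouville fractional integrals of order `β` on `(a, b)`:
`(1 / Γ(β)) ∫_a^x (x - y)^(β-1) f(y) dy` and `(1 / Γ(β)) ∫_x^b (y - x)^(β-1) f(y) dy`. -/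
noncomputable def fracInt (s : Side) (a b β : ℝ) (f : ℝ → ℝ) (x : ℝ) : ℝ :=
  match s with
  | .left => (Real.Gamma β)⁻¹ * ∫ y in Ioo a x, (x - y) ^ (β - 1) * f y
  | .right => (Real.Gamma β)⁻¹ * ∫ y in Ioo x b, (y - x) ^ (β - 1) * f y

/-- The space `C_0^∞(Ω)` of test functions, extended by zero. -/
def IsTestFunction (a b : ℝ) (φ : ℝ → ℝ) : Prop :=
  ContDiff ℝ ∞ φ ∧ HasCompactSupport φ ∧ tsupport φ ⊆ Ioo a b

/-- The classical left and right derivatives of order `α ∈ (0, 1)` of a test function, in Caputo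
form (on test functions it coincides with the Riemann-Liouville form). -/
noncomputable def classicalFracDeriv (s : Side) (a b α : ℝ) (φ : ℝ → ℝ) (x : ℝ) : ℝ :=
  match s with
  | .left => fracInt .left a b (1 - α) (deriv φ) x
  | .right => - fracInt .right a b (1 - α) (deriv φ) x

/-- `v` is the left/right weak fractional derivative of order `α ∈ (0, 1)` of `u ∈ L¹(Ω)`. -/
def IsWeakFracDeriv (s : Side) (a b α : ℝ) (u v : ℝ → ℝ) : Prop :=
  IntegrableOn u (Ioo a b) ∧ LocallyIntegrableOn v (Ioo a b) ∧
    ∀ φ : ℝ → ℝ, IsTestFunction a b φ →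
      ∫ x in Ioo a b, v x * φ x = ∫ x in Ioo a b, u x * classicalFracDeriv s.opp a b α φ x

/-- The left/right weak fractional derivative of `u` exists. -/
def HasWeakFracDeriv (s : Side) (a b α : ℝ) (u : ℝ → ℝ) : Prop :=
  ∃ v, IsWeakFracDeriv s a b α u v

open Classical in
/-- The left/right weak fractional derivative of `u`: a representative of it if it exists
(it is unique almost everywhere, see `IsWeakFracDeriv.ae_eq`), and `0` otherwise. -/
noncomputable def weakFracDeriv (s : Side) (a b α : ℝ) (u : ℝ → ℝ) : ℝ → ℝ :=
  if h : HasWeakFracDeriv s a b α u then h.choose else 0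

theorem isWeakFracDeriv_weakFracDeriv {s : Side} {a b α : ℝ} {u : ℝ → ℝ}
    (h : HasWeakFracDeriv s a b α u) :
    IsWeakFracDeriv s a b α u (weakFracDeriv s a b α u) := by
  rw [weakFracDeriv, dif_pos h]
  exact h.choose_spec

theorem IsWeakFracDeriv.ae_eq {s : Side} {a b α : ℝ} {u v w : ℝ → ℝ}
    (hv : IsWeakFracDeriv s a b α u v) (hw : IsWeakFracDeriv s a b α u w) :
    v =ᵐ[vol a b] w := by
  have hl : LocallyIntegrableOn (fun x => v x - w x) (Ioo a b) := hv.2.1.sub hw.2.1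
  have key : ∀ᵐ x, x ∈ Ioo a b → v x - w x = 0 := by
    refine isOpen_Ioo.ae_eq_zero_of_integral_contDiff_smul_eq_zero hl ?_
    intro φ h1 h2 h3
    have hφ : IsTestFunction a b φ := ⟨h1, h2, h3⟩
    have e := (hv.2.2 φ hφ).trans (hw.2.2 φ hφ).symm
    have integ : ∀ f : ℝ → ℝ, LocallyIntegrableOn f (Ioo a b) →
        Integrable (fun x => f x * φ x) (volume.restrict (Ioo a b)) := by
      intro f hf
      have hk : IntegrableOn f (tsupport φ) := hf.integrableOn_compact_subset h3 h2
      have hm : IntegrableOn (fun x => f x * φ x) (tsupport φ) :=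
        hk.mul_continuousOn h1.continuous.continuousOn h2
      have hi : Integrable (fun x => f x * φ x) := by
        rw [← integrableOn_iff_integrable_of_support_subset (s := tsupport φ)]
        · exact hm
        · intro x hx
          exact subset_tsupport φ (by
            intro h0
            exact hx (by simp [h0]))
      exact hi.integrableOn
    have hz : ∫ x in Ioo a b, (v x - w x) * φ x = 0 := by
      simp only [sub_mul]
      rw [integral_sub (integ v hv.2.1) (integ w hw.2.1), e, sub_self]
    rw [← hz, setIntegral_eq_integral_of_forall_compl_eq_zero]
    · simp [mul_comm]
    · intro x hx
      have : φ x = 0 := by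
        by_contra h0
        exact hx (h3 (subset_tsupport φ h0))
      simp [this]
  have key2 : ∀ᵐ x ∂(vol a b), v x - w x = 0 := (ae_restrict_iff' measurableSet_Ioo).2 key
  filter_upwards [key2] with x hx
  linarith

/-- The left/right fractional Sobolev space of order `α ∈ (0, 1)`: `u ∈ L^p(Ω)` with weak
fractional derivative in `L^p(Ω)`. -/
def fracSobolev (s : Side) (a b α p : ℝ) : Set (ℝ → ℝ) :=
  {u | MemLp u (ENNReal.ofReal p) (vol a b) ∧ HasWeakFracDeriv s a b α u ∧
    MemLp (weakFracDeriv s a b α u) (ENNReal.ofReal p) (vol a b)}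

/-- The left/right Dirichlet `p`-energy. -/
noncomputable def energy (s : Side) (a b α p : ℝ) (u : ℝ → ℝ) : ℝ :=
  p⁻¹ * ∫ x in Ioo a b, |weakFracDeriv s a b α u x| ^ p

/-- The punctured one-sided neighbourhoods in `Ω` of the endpoint at which the trace is taken:
`b` for the left direction, `a` for the right direction. -/
def traceFilter (s : Side) (a b : ℝ) : Filter ℝ :=
  match s with
  | .left => 𝓝[<] b
  | .right => 𝓝[>] a

/-- The left/right trace of `f` exists and equals `t`: a representative of the class of `f` on `Ω`
extends continuously to the endpoint `b` (left) or `a` (right), with value `t` there. -/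
def HasTrace (s : Side) (a b : ℝ) (f : ℝ → ℝ) (t : ℝ) : Prop :=
  ∃ g : ℝ → ℝ, g =ᵐ[vol a b] f ∧ Tendsto g (traceFilter s a b) (𝓝 t)

theorem HasTrace.unique {s : Side} {a b : ℝ} (hab : a < b) {f : ℝ → ℝ} {t t' : ℝ}
    (h : HasTrace s a b f t) (h' : HasTrace s a b f t') : t = t' := by
  obtain ⟨g, hg, hgt⟩ := h
  obtain ⟨g', hg', hgt'⟩ := h'
  have hfr : ∃ᶠ x in traceFilter s a b, g x = g' x := by
    intro hev
    have hae : ∀ᵐ x ∂(vol a b), g x = g' x := hg.trans hg'.symm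
    have hae' : ∀ᵐ x, x ∈ Ioo a b → g x = g' x := (ae_restrict_iff' measurableSet_Ioo).1 hae
    have : ∃ c d, c < d ∧ Ioo c d ⊆ Ioo a b ∧ ∀ x ∈ Ioo c d, ¬ g x = g' x := by
      cases s with
      | left =>
        obtain ⟨c, hc, hcs⟩ := (mem_nhdsLT_iff_exists_mem_Ico_Ioo_subset hab).1 hev
        exact ⟨c, b, hc.2, Ioo_subset_Ioo_left hc.1, hcs⟩
      | right =>
        obtain ⟨d, hd, hds⟩ := (mem_nhdsGT_iff_exists_mem_Ioc_Ioo_subset hab).1 hev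
        exact ⟨a, d, hd.1, Ioo_subset_Ioo_right hd.2, hds⟩
    obtain ⟨c, d, hcd, hsub, hne⟩ := this
    have hz : volume (Ioo c d) = 0 :=
      by
      refine measure_mono_null (fun x hx => ?_) (ae_iff.1 hae')
      intro hh
      exact hne x hx (hh (hsub hx))
    rw [Real.volume_Ioo, ENNReal.ofReal_eq_zero] at hz
    linarith
  by_contra hne
  obtain ⟨U, V, hU, hV, hUt, hVt, hd⟩ := t2_separation hne
  refine hfr ?_
  filter_upwards [hgt (hU.mem_nhds hUt), hgt' (hV.mem_nhds hVt)] with x hx hx' he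
  exact disjoint_left.1 hd hx (by rw [mem_preimage, ← he] at hx'; exact hx')

/-- The subspace of those `u` in the left/right fractional Sobolev space whose coefficient of the
kernel function vanishes: the left integral `I^(1-α) u` vanishes at `a`, respectively the right
integral `I^(1-α) u` vanishes at `b`. -/
def fracSobolevRing (s : Side) (a b α p : ℝ) : Set (ℝ → ℝ) :=
  {u | u ∈ fracSobolev s a b α p ∧ HasTrace s.opp a b (fracInt s a b (1 - α) u) 0}

/-- The flux `|D^α u|^(p-2) D^α u`. -/
noncomputable def flux (s : Side) (a b α p : ℝ) (u : ℝ → ℝ) (x : ℝ) : ℝ :=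
  |weakFracDeriv s a b α u x| ^ (p - 2) * weakFracDeriv s a b α u x

/-- The left/right fractional `p`-Laplacian: the opposite weak fractional derivative of the flux. -/
noncomputable def fracLaplacian (s : Side) (a b α p : ℝ) (u : ℝ → ℝ) : ℝ → ℝ :=
  weakFracDeriv s.opp a b α (flux s a b α p u)

/-- The left/right fractional `p`-Laplacian of `u` exists as a function. -/
def HasFracLaplacian (s : Side) (a b α p : ℝ) (u : ℝ → ℝ) : Prop :=
  HasWeakFracDeriv s.opp a b α (flux s a b α p u)

/-- The left/right fractional Neumann boundary operator is defined at `u` and has the value `n`: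
the trace of the opposite fractional integral of order `1 - α` of the flux is `n`. -/
def HasNeumann (s : Side) (a b α p : ℝ) (u : ℝ → ℝ) (n : ℝ) : Prop :=
  HasTrace s a b (fracInt s.opp a b (1 - α) (flux s a b α p u)) n

/-- The fractional Green identity for `u` and `v`, together with the existence of all its terms. -/
def GreenIdentity (s : Side) (a b α p : ℝ) (u v : ℝ → ℝ) : Prop :=
  HasWeakFracDeriv s a b α v ∧
  IntegrableOn (fun x => flux s a b α p u x * weakFracDeriv s a b α v x) (Ioo a b) ∧
  IntegrableOn (fun x => fracLaplacian s a b α p u x * v x) (Ioo a b) ∧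
  ∃ n t : ℝ, HasNeumann s a b α p u n ∧ HasTrace s a b v t ∧
    ∫ x in Ioo a b, flux s a b α p u x * weakFracDeriv s a b α v x =
      (∫ x in Ioo a b, fracLaplacian s a b α p u x * v x) + n * t

end FracCalc

open FracCalc

namespace FracCalc


/-! Green's identity rests on a fundamental theorem of calculus. If `v` has an integrable weak
derivative `h` of order α, then `v = c · k_α(·, e) + I^α h` almost everywhere, where `k_α` is the
Riesz kernel, `e` is the endpoint where integration starts, and `c` is the trace of `I^(1-α) v` at
`e` (`IsWeakFracDeriv.exists_ae_eq`). To see this, move `I^(1-α)` off the test function by Fubini.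
By du Bois-Reymond, `I^(1-α) v - I^1 h` is a constant `c`. Since `I^(1-α) k_α(·, e) = 1` and
`I^(1-α) I^α = I^1` (a Beta integral), the injectivity of `I^(1-α)` gives the formula. That
injectivity is itself the uniqueness of weak derivatives.

The theorem is used in the opposite direction for the flux: flux `= n · k + I^α_opp (Δu)`, and `n`
is the Neumann value. The test function is `v = I^α h`; for `v` in the ring space the coefficient
vanishes by definition. Multiplying the flux by `h` and integrating, the symmetry of the kernel
turns the first term into `n · (I^α h)(e')` at the other endpoint `e'`, and Fubini turns the second
into `∫ Δu · v` (`greenIdentity_of_ae_eq`).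

The three cases differ in how the double integral and the boundary term are controlled. For smooth
`v`, `h` is explicit and `∫ k_α(x, y) |h y| dy` is bounded uniformly in `x`. For `αp > 1` the same
bound follows from Young's inequality, since the kernel has integrable `p/(p-1)`-th power, and `I^α
h` is continuous up to `e'`. If `αp ≤ 1` and `Δu` is in the dual space, that power is not integrable
while the flux and `I^α_opp (Δu)` do lie in the dual space; hence `n = 0` and no boundary term
remains.

The natural boundary condition only needs comparison with `0`: a minimizer has zero energy, hence
zero flux. -/

/-! ### Riesz kernels: mass, symmetry and the Beta integral. -/

/-- The Riesz kernel `t₊^(β-1) / Γ(β)`. -/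
noncomputable def rieszKernel (β t : ℝ) : ℝ :=
  if 0 < t then (Real.Gamma β)⁻¹ * t ^ (β - 1) else 0

/-- The integral kernel of `fracInt s a b β`. -/
noncomputable def kernel (s : Side) (β x y : ℝ) : ℝ :=
  match s with
  | .left => rieszKernel β (x - y)
  | .right => rieszKernel β (y - x)

/-- The endpoint at which the integration in `fracInt s a b β` starts. -/
def Side.base (s : Side) (a b : ℝ) : ℝ :=
  match s with
  | .left => a
  | .right => b

theorem Side.opp_opp (s : Side) : s.opp.opp = s := by cases s <;> rfl

theorem Side.base_mem (s : Side) {a b : ℝ} (hab : a < b) : s.base a b ∈ Icc a b := by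
  cases s
  · exact ⟨le_rfl, hab.le⟩
  · exact ⟨hab.le, le_rfl⟩

theorem rieszKernel_nonneg {β : ℝ} (hβ : 0 < β) (t : ℝ) : 0 ≤ rieszKernel β t := by
  unfold rieszKernel
  split_ifs with h
  · have := Real.Gamma_pos_of_pos hβ
    positivity
  · exact le_rfl

theorem measurable_rieszKernel (β : ℝ) : Measurable (rieszKernel β) := by
  unfold rieszKernel
  exact Measurable.ite measurableSet_Ioi (by fun_prop) measurable_const

theorem kernel_nonneg (s : Side) {β : ℝ} (hβ : 0 < β) (x y : ℝ) : 0 ≤ kernel s β x y := by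
  cases s <;> exact rieszKernel_nonneg hβ _

theorem measurable_kernel (s : Side) (β : ℝ) :
    Measurable (Function.uncurry (kernel s β)) := by
  cases s
  · exact (measurable_rieszKernel β).comp (measurable_fst.sub measurable_snd)
  · exact (measurable_rieszKernel β).comp (measurable_snd.sub measurable_fst)

theorem measurable_kernel_right (s : Side) (β x : ℝ) : Measurable (kernel s β x) :=
  (measurable_kernel s β).comp (measurable_const.prodMk measurable_id)

theorem measurable_kernel_left (s : Side) (β y : ℝ) : Measurable (fun x => kernel s β x y) :=
  (measurable_kernel s β).comp (measurable_id.prodMk measurable_const)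

theorem kernel_opp (s : Side) (β x y : ℝ) : kernel s.opp β x y = kernel s β y x := by
  cases s <;> rfl

instance isFiniteMeasure_vol (a b : ℝ) : IsFiniteMeasure (vol a b) := by
  unfold vol; infer_instance

theorem ae_mem_Ioo (a b : ℝ) : ∀ᵐ x ∂vol a b, x ∈ Ioo a b :=
  ae_restrict_mem measurableSet_Ioo

theorem fracInt_eq (s : Side) {a b x : ℝ} (β : ℝ) (f : ℝ → ℝ) (hx : x ∈ Icc a b) :
    fracInt s a b β f x = ∫ y, kernel s β x y * f y ∂vol a b := by
  cases s
  · have h : ∀ y, kernel .left β x y * f y =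
        (Iio x).indicator (fun y => (Real.Gamma β)⁻¹ * ((x - y) ^ (β - 1) * f y)) y := by
      intro y
      simp only [kernel, rieszKernel, indicator, mem_Iio, sub_pos]
      split_ifs <;> ring
    simp only [h, vol, fracInt]
    rw [integral_indicator measurableSet_Iio, Measure.restrict_restrict measurableSet_Iio,
      Iio_inter_Ioo, min_eq_left hx.2, integral_const_mul]
  · have h : ∀ y, kernel .right β x y * f y =
        (Ioi x).indicator (fun y => (Real.Gamma β)⁻¹ * ((y - x) ^ (β - 1) * f y)) y := by
      intro y
      simp only [kernel, rieszKernel, indicator, mem_Ioi, sub_pos]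
      split_ifs <;> ring
    simp only [h, vol, fracInt]
    rw [integral_indicator measurableSet_Ioi, Measure.restrict_restrict measurableSet_Ioi,
      Ioi_inter_Ioo, max_eq_left hx.1, integral_const_mul]

theorem lintegral_rieszKernel {β L : ℝ} (hβ : 0 < β) (hL : 0 ≤ L) :
    ∫⁻ t in Ioo 0 L, ENNReal.ofReal (rieszKernel β t) =
      ENNReal.ofReal ((Real.Gamma β)⁻¹ * (L ^ β / β)) := by
  have e : ∫⁻ t in Ioo 0 L, ENNReal.ofReal (rieszKernel β t) =
      ∫⁻ t in Ioo 0 L, ENNReal.ofReal ((Real.Gamma β)⁻¹ * t ^ (β - 1)) := by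
    refine setLIntegral_congr_fun measurableSet_Ioo fun t ht => ?_
    simp [rieszKernel, ht.1]
  have hG := Real.Gamma_pos_of_pos hβ
  have hi : IntervalIntegrable (fun t : ℝ => t ^ (β - 1)) volume 0 L :=
    intervalIntegral.intervalIntegrable_rpow' (by linarith)
  have hi' : IntegrableOn (fun t : ℝ => t ^ (β - 1)) (Ioo 0 L) :=
    ((intervalIntegrable_iff_integrableOn_Ioc_of_le hL).1 hi).mono_set Ioo_subset_Ioc_self
  rw [e, ← ofReal_integral_eq_lintegral_ofReal (hi'.const_mul _), integral_const_mul,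
    ← integral_Ioc_eq_integral_Ioo, ← intervalIntegral.integral_of_le hL,
    integral_rpow (Or.inl (by linarith)), sub_add_cancel, Real.zero_rpow hβ.ne', sub_zero]
  filter_upwards [ae_restrict_mem measurableSet_Ioo] with t ht
  have := ht.1
  positivity

theorem lintegral_kernel (s : Side) {a b β x : ℝ} (hβ : 0 < β) (hx : x ∈ Icc a b) :
    ∫⁻ y, ENNReal.ofReal (kernel s β x y) ∂vol a b =
      ENNReal.ofReal ((Real.Gamma β)⁻¹ * (|x - s.base a b| ^ β / β)) := by
  -- One substitution serves both directions: `f` is `x - y` or `y - x`, and points with `f y ≤ 0`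
  -- do not contribute.
  have key : ∀ c : ℝ, ∀ f : ℝ → ℝ, ∀ S : Set ℝ, MeasurePreserving f volume volume →
      MeasurableEmbedding f → 0 ≤ c → MeasurableSet S →
      (∀ y, y ∈ S ∧ 0 < f y ↔ f y ∈ Ioo 0 c) →
      ∫⁻ y in S, ENNReal.ofReal (rieszKernel β (f y)) =
        ENNReal.ofReal ((Real.Gamma β)⁻¹ * (c ^ β / β)) := by
    intro c f S hf hf' hc hS h
    rw [← lintegral_rieszKernel hβ hc, ← hf.setLIntegral_comp_preimage_emb hf' _ (Ioo 0 c),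
      ← lintegral_indicator hS, ← lintegral_indicator (hf.measurable measurableSet_Ioo)]
    refine lintegral_congr fun y => ?_
    by_cases h0 : 0 < f y
    · by_cases h1 : y ∈ S
      · rw [indicator_of_mem h1, indicator_of_mem (show y ∈ f ⁻¹' Ioo 0 c from (h y).1 ⟨h1, h0⟩)]
      · rw [indicator_of_notMem h1, indicator_of_notMem]
        exact fun h2 => h1 ((h y).2 h2).1
    · have : rieszKernel β (f y) = 0 := if_neg h0
      simp [indicator, this]
  cases s
  · refine key _ (fun y => x - y) (Ioo a b) (Measure.measurePreserving_sub_left volume x)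
      (MeasurableEquiv.subLeft x).measurableEmbedding (abs_nonneg _) measurableSet_Ioo fun y => ?_
    simp only [Side.base, abs_of_nonneg (sub_nonneg.2 hx.1), mem_Ioo]
    constructor
    · rintro ⟨h1, h2⟩; constructor <;> linarith
    · rintro ⟨h1, h2⟩; refine ⟨⟨?_, ?_⟩, ?_⟩ <;> linarith [hx.2]
  · refine key _ (fun y => y - x) (Ioo a b) (measurePreserving_sub_right volume x)
      (MeasurableEquiv.subRight x).measurableEmbedding (abs_nonneg _) measurableSet_Ioo fun y => ?_
    simp only [Side.base, abs_of_nonpos (sub_nonpos.2 hx.2), mem_Ioo]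
    constructor
    · rintro ⟨h1, h2⟩; constructor <;> linarith
    · rintro ⟨h1, h2⟩; refine ⟨⟨?_, ?_⟩, ?_⟩ <;> linarith [hx.1]

theorem lintegral_kernel_le (s : Side) {a b β x : ℝ} (hβ : 0 < β) (hx : x ∈ Icc a b) :
    ∫⁻ y, ENNReal.ofReal (kernel s β x y) ∂vol a b ≤
      ENNReal.ofReal ((Real.Gamma β)⁻¹ * ((b - a) ^ β / β)) := by
  rw [lintegral_kernel s hβ hx]
  have hG := Real.Gamma_pos_of_pos hβ
  have h : |x - s.base a b| ≤ b - a := by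
    cases s
    · simpa [Side.base, abs_of_nonneg (sub_nonneg.2 hx.1)] using hx.2
    · rw [Side.base, abs_of_nonpos (sub_nonpos.2 hx.2)]; linarith [hx.1]
  gcongr

/-- The substitution `y = z + (x - z) t` makes the integrand the density of the Beta distribution
with parameters `1 - α` and `α`. The powers of `x - z` cancel against the Jacobian, and the
constants match because `Γ(1) = 1`. -/
theorem lintegral_beta_kernel {α : ℝ} (hα0 : 0 < α) (hα1 : α < 1) {x z : ℝ} (hxz : z < x) :
    ∫⁻ y in Ioo z x, ENNReal.ofReal (rieszKernel α (x - y) * rieszKernel (1 - α) (y - z)) = 1 := by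
  have hL : 0 < x - z := sub_pos.2 hxz
  have himg : (fun t : ℝ => z + (x - z) * t) '' Ioo 0 1 = Ioo z x := by
    ext y
    constructor
    · rintro ⟨t, ht, rfl⟩
      constructor
      · have := mul_pos hL ht.1
        simp only; linarith
      · have := mul_lt_mul_of_pos_left ht.2 hL
        simp only; linarith
    · intro hy
      refine ⟨(y - z) / (x - z), ⟨div_pos (sub_pos.2 hy.1) hL, (div_lt_one hL).2 ?_⟩, ?_⟩
      · linarith [hy.2]
      · simp only; field_simp; ring
  rw [← himg, lintegral_image_eq_lintegral_abs_deriv_mul measurableSet_Ioo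
    (f' := fun _ => x - z) (fun t _ => by
      have := ((hasDerivAt_id t).const_mul (x - z)).const_add z
      simpa using this.hasDerivWithinAt)
    (fun t _ t' _ h => by
      simpa [hL.ne'] using h)]
  rw [← ProbabilityTheory.lintegral_betaPDF_eq_one (sub_pos.2 hα1) hα0,
    ProbabilityTheory.lintegral_betaPDF]
  refine setLIntegral_congr_fun measurableSet_Ioo fun t ht => ?_
  have h1 : x - (z + (x - z) * t) = (x - z) * (1 - t) := by ring
  have h2 : z + (x - z) * t - z = (x - z) * t := by ring
  have ht' : 0 < 1 - t := sub_pos.2 ht.2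
  have ht0 := ht.1
  simp only [h1, h2, rieszKernel]
  rw [if_pos (mul_pos hL ht'), if_pos (mul_pos hL ht0), abs_of_pos hL,
    ← ENNReal.ofReal_mul hL.le, Real.mul_rpow hL.le ht'.le, Real.mul_rpow hL.le ht0.le,
    ProbabilityTheory.beta, sub_add_cancel, Real.Gamma_one]
  congr 1
  have h3 : (x - z) * ((x - z) ^ (α - 1) * (x - z) ^ (1 - α - 1)) = 1 := by
    rw [← Real.rpow_add hL, show α - 1 + (1 - α - 1) = -1 by ring, Real.rpow_neg_one,
      mul_inv_cancel₀ hL.ne']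
  have hG1 := (Real.Gamma_pos_of_pos hα0).ne'
  have hG2 := (Real.Gamma_pos_of_pos (sub_pos.2 hα1)).ne'
  calc _ = ((x - z) * ((x - z) ^ (α - 1) * (x - z) ^ (1 - α - 1))) *
        ((Real.Gamma α)⁻¹ * (Real.Gamma (1 - α))⁻¹ * t ^ (1 - α - 1) * (1 - t) ^ (α - 1)) := by ring
    _ = _ := by rw [h3]; field_simp

/-- The semigroup law `I^α I^(1-α) = I^1` at the level of kernels; the kernel of order one is the
indicator of one point lying beyond the other. -/
theorem lintegral_kernel_mul_kernel (s : Side) {α : ℝ} (hα0 : 0 < α) (hα1 : α < 1) {a b x z : ℝ}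
    (hx : x ∈ Icc a b) (hz : z ∈ Icc a b) :
    ∫⁻ y, ENNReal.ofReal (kernel s α x y * kernel s (1 - α) y z) ∂vol a b =
      ENNReal.ofReal (kernel s 1 x z) := by
  have left : ∀ {α : ℝ}, 0 < α → α < 1 → ∀ {x z : ℝ}, x ∈ Icc a b → z ∈ Icc a b →
      ∫⁻ y in Ioo a b, ENNReal.ofReal (rieszKernel α (x - y) * rieszKernel (1 - α) (y - z)) =
      ENNReal.ofReal (rieszKernel 1 (x - z)) := by
    intro α hα0 hα1 x z hx hz
    have h : ∀ y, ENNReal.ofReal (rieszKernel α (x - y) * rieszKernel (1 - α) (y - z)) =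
        (Ioo z x).indicator
          (fun y => ENNReal.ofReal (rieszKernel α (x - y) * rieszKernel (1 - α) (y - z))) y := by
      intro y
      by_cases hy : y ∈ Ioo z x
      · rw [indicator_of_mem hy]
      · rw [indicator_of_notMem hy]
        by_cases h1 : z < y
        · have h2 : ¬ 0 < x - y := fun h => hy ⟨h1, by linarith⟩
          simp [rieszKernel, h2]
        · have h2 : ¬ 0 < y - z := fun h => h1 (by linarith)
          simp [rieszKernel, h2]
    rw [lintegral_congr h, lintegral_indicator measurableSet_Ioo,
      Measure.restrict_restrict measurableSet_Ioo,
      inter_eq_left.2 (Ioo_subset_Ioo hz.1 hx.2)]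
    by_cases hxz : z < x
    · rw [lintegral_beta_kernel hα0 hα1 hxz]
      simp [rieszKernel, hxz]
    · simp [rieszKernel, hxz]
  cases s
  · exact left hα0 hα1 hx hz
  -- Reflection exchanges `x` with `z`, and hence `α` with `1 - α`.
  · have := left (sub_pos.2 hα1) (by linarith : 1 - α < 1) hz hx
    rw [sub_sub_cancel] at this
    simpa only [kernel, mul_comm, vol] using this


/-! ### Fractional integration by parts and the semigroup law. -/

/-- The sign of the derivative that is inverse to `fracInt s a b 1`. -/
def Side.sign (s : Side) : ℝ :=
  match s with
  | .left => 1
  | .right => -1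

theorem Side.sign_mul_self (s : Side) : s.sign * s.sign = 1 := by
  cases s <;> norm_num [Side.sign]

theorem classicalFracDeriv_eq (s : Side) (a b α : ℝ) (φ : ℝ → ℝ) (x : ℝ) :
    classicalFracDeriv s a b α φ x = s.sign * fracInt s a b (1 - α) (deriv φ) x := by
  cases s <;> simp [classicalFracDeriv, Side.sign]

theorem ofReal_kernel_one_le (s : Side) (x y : ℝ) : ENNReal.ofReal (kernel s 1 x y) ≤ 1 := by
  rw [← ENNReal.ofReal_one]
  apply ENNReal.ofReal_le_ofReal
  cases s <;> simp only [kernel, rieszKernel] <;> split_ifs <;> simp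

theorem enorm_kernel (s : Side) {β : ℝ} (hβ : 0 < β) (x y : ℝ) :
    ‖kernel s β x y‖ₑ = ENNReal.ofReal (kernel s β x y) :=
  Real.enorm_of_nonneg (kernel_nonneg s hβ x y)

theorem fracInt_one (s : Side) {a b x : ℝ} (f : ℝ → ℝ) (hx : x ∈ Icc a b) :
    fracInt s a b 1 f x = s.sign * ∫ y in s.base a b..x, f y := by
  cases s
  · simp [fracInt, Side.sign, Side.base, intervalIntegral.integral_of_le hx.1,
      integral_Ioc_eq_integral_Ioo]
  · simp [fracInt, Side.sign, Side.base, intervalIntegral.integral_of_ge hx.2,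
      integral_Ioc_eq_integral_Ioo]

/-- Absolute convergence of the double integral of `g x * kernel s β x y * h y`. -/
def KernelIntegrable (s : Side) (a b β : ℝ) (g h : ℝ → ℝ) : Prop :=
  Integrable (fun z : ℝ × ℝ => g z.1 * kernel s β z.1 z.2 * h z.2) ((vol a b).prod (vol a b))

theorem KernelIntegrable.swap {s : Side} {a b β : ℝ} {g h : ℝ → ℝ}
    (H : KernelIntegrable s a b β g h) : KernelIntegrable s.opp a b β h g := by
  refine (Integrable.swap H).congr (Eventually.of_forall fun z => ?_)
  simp only [Function.comp, Prod.fst_swap, Prod.snd_swap, kernel_opp]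
  ring

theorem KernelIntegrable.integrable {s : Side} {a b β : ℝ} {g h : ℝ → ℝ}
    (H : KernelIntegrable s a b β g h) :
    Integrable (fun x => g x * fracInt s a b β h x) (vol a b) := by
  refine (Integrable.integral_prod_left H).congr ?_
  filter_upwards [ae_mem_Ioo a b] with x hx
  simp only [fracInt_eq s β h (Ioo_subset_Icc_self hx), mul_assoc, integral_const_mul]

/-- Fractional integration by parts: transposing the kernel reverses the direction, so this is
Fubini. -/
theorem KernelIntegrable.integral_eq {s : Side} {a b β : ℝ} {g h : ℝ → ℝ}
    (H : KernelIntegrable s a b β g h) :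
    ∫ x, g x * fracInt s a b β h x ∂vol a b = ∫ x, fracInt s.opp a b β g x * h x ∂vol a b := by
  have e1 : ∫ x, g x * fracInt s a b β h x ∂vol a b =
      ∫ x, ∫ y, g x * kernel s β x y * h y ∂vol a b ∂vol a b := by
    refine integral_congr_ae ?_
    filter_upwards [ae_mem_Ioo a b] with x hx
    simp only [fracInt_eq s β h (Ioo_subset_Icc_self hx), mul_assoc, integral_const_mul]
  have e2 : ∫ y, fracInt s.opp a b β g y * h y ∂vol a b =
      ∫ y, ∫ x, g x * kernel s β x y * h y ∂vol a b ∂vol a b := by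
    refine integral_congr_ae ?_
    filter_upwards [ae_mem_Ioo a b] with y hy
    simp only [fracInt_eq s.opp β g (Ioo_subset_Icc_self hy), integral_mul_const, kernel_opp]
    congr 1
    exact integral_congr_ae (Eventually.of_forall fun x => mul_comm _ _)
  rw [e1, e2]
  exact integral_integral_swap H

theorem kernelIntegrable_of_lintegral {s : Side} {a b β : ℝ} (hβ : 0 < β) {g h : ℝ → ℝ}
    (hg : AEStronglyMeasurable g (vol a b)) (hh : AEStronglyMeasurable h (vol a b))
    (H : ∫⁻ x, ∫⁻ y, ‖g x‖ₑ * (ENNReal.ofReal (kernel s β x y) * ‖h y‖ₑ) ∂vol a b ∂vol a b < ⊤) :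
    KernelIntegrable s a b β g h := by
  have hm : AEStronglyMeasurable (fun z : ℝ × ℝ => g z.1 * kernel s β z.1 z.2 * h z.2)
      ((vol a b).prod (vol a b)) :=
    (hg.comp_fst.mul (measurable_kernel s β).aestronglyMeasurable).mul hh.comp_snd
  refine ⟨hm, ?_⟩
  rw [HasFiniteIntegral, lintegral_prod _ hm.enorm]
  simpa only [enorm_mul, enorm_kernel s hβ, mul_assoc] using H

/-- Tonelli with an asymmetric split: `g` is merely integrable, and `h` absorbs the singularity of
the kernel uniformly in `x`. With `KernelIntegrable.swap` the roles can be exchanged. -/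
theorem kernelIntegrable_of_bound {s : Side} {a b β : ℝ} (hβ : 0 < β) {g h : ℝ → ℝ}
    (hg : Integrable g (vol a b)) (hh : AEStronglyMeasurable h (vol a b)) {C : ENNReal}
    (hC : C ≠ ⊤)
    (H : ∀ x ∈ Ioo a b, ∫⁻ y, ENNReal.ofReal (kernel s β x y) * ‖h y‖ₑ ∂vol a b ≤ C) :
    KernelIntegrable s a b β g h := by
  refine kernelIntegrable_of_lintegral hβ hg.1 hh ?_
  calc _ ≤ ∫⁻ x, ‖g x‖ₑ * C ∂vol a b := by
        refine lintegral_mono_ae ?_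
        filter_upwards [ae_mem_Ioo a b] with x hx
        rw [lintegral_const_mul' _ _ enorm_ne_top]
        gcongr
        exact H x hx
    _ = (∫⁻ x, ‖g x‖ₑ ∂vol a b) * C := lintegral_mul_const'' _ hg.1.enorm
    _ < ⊤ := ENNReal.mul_lt_top hg.2 hC.lt_top

theorem lintegral_kernel_mul_le (s : Side) {a b β x M : ℝ} (hβ : 0 < β) (hx : x ∈ Icc a b)
    {f : ℝ → ℝ} (hf : ∀ y ∈ Ioo a b, |f y| ≤ M) :
    ∫⁻ y, ENNReal.ofReal (kernel s β x y) * ‖f y‖ₑ ∂vol a b ≤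
      ENNReal.ofReal ((Real.Gamma β)⁻¹ * ((b - a) ^ β / β)) * ENNReal.ofReal M := by
  calc _ ≤ ∫⁻ y, ENNReal.ofReal (kernel s β x y) * ENNReal.ofReal M ∂vol a b := by
        refine lintegral_mono_ae ?_
        filter_upwards [ae_mem_Ioo a b] with y hy
        rw [← ofReal_norm, Real.norm_eq_abs]
        gcongr
        exact hf y hy
    _ = (∫⁻ y, ENNReal.ofReal (kernel s β x y) ∂vol a b) * ENNReal.ofReal M :=
        lintegral_mul_const _ (measurable_kernel_right s β x).ennreal_ofReal
    _ ≤ _ := by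
        gcongr
        exact lintegral_kernel_le s hβ hx

theorem enorm_fracInt_le (s : Side) {a b β x : ℝ} (hβ : 0 < β) (hx : x ∈ Icc a b) (f : ℝ → ℝ) :
    ‖fracInt s a b β f x‖ₑ ≤ ∫⁻ y, ENNReal.ofReal (kernel s β x y) * ‖f y‖ₑ ∂vol a b := by
  rw [fracInt_eq s β f hx]
  refine (enorm_integral_le_lintegral_enorm _).trans (le_of_eq ?_)
  simp only [enorm_mul, enorm_kernel s hβ]

theorem kernelIntegrable_one {s : Side} {a b β : ℝ} (hβ : 0 < β) {h : ℝ → ℝ}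
    (hh : Integrable h (vol a b)) : KernelIntegrable s a b β (fun _ => 1) h := by
  have : KernelIntegrable s.opp a b β h (fun _ => 1) :=
    kernelIntegrable_of_bound hβ hh aestronglyMeasurable_const (by finiteness)
      fun x hx => lintegral_kernel_mul_le (M := 1) s.opp hβ (Ioo_subset_Icc_self hx) (by simp)
  simpa only [Side.opp_opp] using this.swap

theorem integrable_fracInt (s : Side) {a b β : ℝ} (hβ : 0 < β) {h : ℝ → ℝ}
    (hh : Integrable h (vol a b)) : Integrable (fracInt s a b β h) (vol a b) := by
  simpa using (kernelIntegrable_one (s := s) hβ hh).integrable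

theorem ae_integrable_kernel_mul (s : Side) {a b β : ℝ} (hβ : 0 < β) {h : ℝ → ℝ}
    (hh : Integrable h (vol a b)) :
    ∀ᵐ x ∂vol a b, Integrable (fun y => kernel s β x y * h y) (vol a b) := by
  have := Integrable.prod_right_ae (kernelIntegrable_one (s := s) hβ hh)
  simpa using this

theorem fracInt_congr (s : Side) {a b β x : ℝ} (hx : x ∈ Icc a b) {f g : ℝ → ℝ}
    (h : f =ᵐ[vol a b] g) : fracInt s a b β f x = fracInt s a b β g x := by
  rw [fracInt_eq s β f hx, fracInt_eq s β g hx]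
  refine integral_congr_ae ?_
  filter_upwards [h] with y hy
  rw [hy]

theorem fracInt_const_mul (s : Side) (a b β c x : ℝ) (f : ℝ → ℝ) :
    fracInt s a b β (fun y => c * f y) x = c * fracInt s a b β f x := by
  cases s <;> simp only [fracInt, mul_left_comm _ c, integral_const_mul]

theorem fracInt_add_ae (s : Side) {a b β : ℝ} (hβ : 0 < β) {f g : ℝ → ℝ}
    (hf : Integrable f (vol a b)) (hg : Integrable g (vol a b)) :
    fracInt s a b β (fun y => f y + g y) =ᵐ[vol a b]
      fun x => fracInt s a b β f x + fracInt s a b β g x := by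
  filter_upwards [ae_mem_Ioo a b, ae_integrable_kernel_mul s hβ hf,
    ae_integrable_kernel_mul s hβ hg] with x hx h1 h2
  have hx := Ioo_subset_Icc_self hx
  rw [fracInt_eq s β _ hx, fracInt_eq s β f hx, fracInt_eq s β g hx, ← integral_add h1 h2]
  simp only [mul_add]

theorem kernel_kernel_bound (s : Side) {α : ℝ} (hα0 : 0 < α) (hα1 : α < 1) {a b x z : ℝ}
    (hx : x ∈ Icc a b) (hz : z ∈ Icc a b) :
    ∫⁻ y, ENNReal.ofReal (kernel s α x y) * ‖kernel s (1 - α) y z‖ₑ ∂vol a b ≤ 1 := by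
  simp only [enorm_kernel s (sub_pos.2 hα1), ← ENNReal.ofReal_mul (kernel_nonneg s hα0 _ _)]
  rw [lintegral_kernel_mul_kernel s hα0 hα1 hx hz]
  exact ofReal_kernel_one_le s x z

theorem fracInt_kernel (s : Side) {α : ℝ} (hα0 : 0 < α) (hα1 : α < 1) {a b x z : ℝ}
    (hx : x ∈ Icc a b) (hz : z ∈ Icc a b) :
    fracInt s a b α (fun y => kernel s (1 - α) y z) x = kernel s 1 x z := by
  rw [fracInt_eq s α _ hx, integral_eq_lintegral_of_nonneg_ae,
    lintegral_kernel_mul_kernel s hα0 hα1 hx hz,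
    ENNReal.toReal_ofReal (kernel_nonneg s one_pos _ _)]
  · exact Eventually.of_forall fun y =>
      mul_nonneg (kernel_nonneg s hα0 _ _) (kernel_nonneg s (sub_pos.2 hα1) _ _)
  · exact ((measurable_kernel_right s α x).mul
      (measurable_kernel_left s (1 - α) z)).aestronglyMeasurable

theorem integrable_kernel_left (s : Side) {β : ℝ} (hβ : 0 < β) {a b z : ℝ} (hz : z ∈ Icc a b) :
    Integrable (fun y => kernel s β y z) (vol a b) := by
  refine ⟨(measurable_kernel_left s β z).aestronglyMeasurable, ?_⟩
  have := (lintegral_kernel_le s.opp hβ hz).trans_lt ENNReal.ofReal_lt_top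
  simpa only [HasFiniteIntegral, enorm_kernel s hβ, kernel_opp] using this

/-- Integration by parts moves the inner integral onto `kernel s α x`, where the Beta integral
evaluates it. The result holds at every point of the closed interval, which matters for boundary
values. -/
theorem fracInt_fracInt (s : Side) {α : ℝ} (hα0 : 0 < α) (hα1 : α < 1) {a b x : ℝ}
    (hx : x ∈ Icc a b) {h : ℝ → ℝ} (hh : Integrable h (vol a b)) :
    fracInt s a b α (fracInt s a b (1 - α) h) x = fracInt s a b 1 h x := by
  have hα' : 0 < 1 - α := sub_pos.2 hα1
  have key : ∀ z ∈ Icc a b, ∫⁻ y, ENNReal.ofReal (kernel s.opp (1 - α) z y) *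
      ‖kernel s α x y‖ₑ ∂vol a b ≤ 1 := fun z hz => by
    refine le_trans (le_of_eq (lintegral_congr fun y => ?_)) (kernel_kernel_bound s hα0 hα1 hx hz)
    rw [kernel_opp, enorm_kernel s hα0, enorm_kernel s hα', mul_comm]
  have H : KernelIntegrable s a b (1 - α) (kernel s α x) h := by
    have := kernelIntegrable_of_bound (s := s.opp) hα' hh
      (measurable_kernel_right s α x).aestronglyMeasurable ENNReal.one_ne_top
      fun z hz => key z (Ioo_subset_Icc_self hz)
    simpa only [Side.opp_opp] using this.swap
  rw [fracInt_eq s α _ hx, H.integral_eq, fracInt_eq s 1 _ hx]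
  refine integral_congr_ae ?_
  filter_upwards [ae_mem_Ioo a b] with z hz
  have hz := Ioo_subset_Icc_self hz
  have := fracInt_kernel s.opp hα' (by linarith : 1 - α < 1) hz hx
  rw [sub_sub_cancel] at this
  simp only [kernel_opp] at this
  rw [this]

/-! ### Weak derivatives of fractional integrals. -/

theorem IsTestFunction.deriv_bounded {a b : ℝ} {φ : ℝ → ℝ} (hφ : IsTestFunction a b φ) :
    ∃ M, ∀ x, |deriv φ x| ≤ M :=
  (hφ.1.continuous_deriv (by simp)).bounded_above_of_compact_support hφ.2.1.deriv

theorem IsTestFunction.apply_base {a b : ℝ} {φ : ℝ → ℝ} (hφ : IsTestFunction a b φ) (s : Side) :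
    φ (s.base a b) = 0 := by
  by_contra h
  have := hφ.2.2 (subset_tsupport φ h)
  cases s
  · exact lt_irrefl _ this.1
  · exact lt_irrefl _ this.2

theorem integrable_of_bounded {a b M : ℝ} {f : ℝ → ℝ}
    (hf : AEStronglyMeasurable f (vol a b)) (hM : ∀ x ∈ Ioo a b, |f x| ≤ M) :
    Integrable f (vol a b) := by
  refine Integrable.mono' (integrable_const M) hf ?_
  filter_upwards [ae_mem_Ioo a b] with x hx using hM x hx

theorem IsTestFunction.integrable_deriv {a b : ℝ} {φ : ℝ → ℝ} (hφ : IsTestFunction a b φ) :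
    Integrable (deriv φ) (vol a b) := by
  obtain ⟨M, hM⟩ := hφ.deriv_bounded
  exact integrable_of_bounded (hφ.1.continuous_deriv (by simp)).aestronglyMeasurable
    fun x _ => hM x

theorem IsTestFunction.fracInt_one_deriv {a b : ℝ} {φ : ℝ → ℝ} (hφ : IsTestFunction a b φ)
    (s : Side) {x : ℝ} (hx : x ∈ Icc a b) : fracInt s a b 1 (deriv φ) x = s.sign * φ x := by
  have hd : Differentiable ℝ φ := hφ.1.differentiable (by simp)
  rw [fracInt_one s _ hx, intervalIntegral.integral_deriv_eq_sub (fun x _ => hd x)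
    ((hφ.1.continuous_deriv (by simp)).intervalIntegrable _ _), hφ.apply_base, sub_zero]

theorem kernelIntegrable_of_bounded_left {s : Side} {a b β M : ℝ} (hβ : 0 < β) {g h : ℝ → ℝ}
    (hg : AEStronglyMeasurable g (vol a b)) (hM : ∀ x ∈ Ioo a b, |g x| ≤ M)
    (hh : Integrable h (vol a b)) : KernelIntegrable s a b β g h := by
  have : KernelIntegrable s.opp a b β h g :=
    kernelIntegrable_of_bound hβ hh hg (by finiteness)
      fun x hx => lintegral_kernel_mul_le s.opp hβ (Ioo_subset_Icc_self hx) hM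
  simpa only [Side.opp_opp] using this.swap

theorem exists_fracInt_bound (s : Side) {a b β M : ℝ} (hβ : 0 < β) {f : ℝ → ℝ}
    (hM : ∀ x ∈ Ioo a b, |f x| ≤ M) : ∃ C, ∀ x ∈ Icc a b, |fracInt s a b β f x| ≤ C := by
  refine ⟨(ENNReal.ofReal ((Real.Gamma β)⁻¹ * ((b - a) ^ β / β)) * ENNReal.ofReal M).toReal,
    fun x hx => ?_⟩
  have := (enorm_fracInt_le s hβ hx f).trans (lintegral_kernel_mul_le s hβ hx hM)
  have := ENNReal.toReal_mono (by finiteness) this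
  simpa using this

/-- A function that is a fractional integral has the integrand as its weak derivative. -/
theorem isWeakFracDeriv_of_ae_eq_fracInt {s : Side} {a b α : ℝ} (hα0 : 0 < α) (hα1 : α < 1)
    {v h : ℝ → ℝ} (hh : Integrable h (vol a b)) (hv : v =ᵐ[vol a b] fracInt s a b α h) :
    IsWeakFracDeriv s a b α v h := by
  refine ⟨(integrable_fracInt s hα0 hh).congr hv.symm,
    IntegrableOn.locallyIntegrableOn hh, fun φ hφ => ?_⟩
  have hα' : 0 < 1 - α := sub_pos.2 hα1
  obtain ⟨M, hM⟩ := hφ.deriv_bounded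
  obtain ⟨C, hC⟩ := exists_fracInt_bound s.opp (a := a) (b := b) hα' (fun x _ => hM x)
  -- The fractional integral of `deriv φ` is bounded, so Fubini applies for every integrable `h`.
  have H : KernelIntegrable s a b α (fracInt s.opp a b (1 - α) (deriv φ)) h :=
    kernelIntegrable_of_bounded_left hα0 (integrable_fracInt s.opp hα' hφ.integrable_deriv).1
      (fun x hx => hC x (Ioo_subset_Icc_self hx)) hh
  have e1 : ∫ x, v x * classicalFracDeriv s.opp a b α φ x ∂vol a b =
      s.opp.sign * ∫ x, fracInt s.opp a b (1 - α) (deriv φ) x * fracInt s a b α h x ∂vol a b := by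
    rw [← integral_const_mul]
    refine integral_congr_ae ?_
    filter_upwards [hv] with x hx
    rw [hx, classicalFracDeriv_eq]
    ring
  have e2 : ∫ x, fracInt s.opp a b α (fracInt s.opp a b (1 - α) (deriv φ)) x * h x ∂vol a b =
      s.opp.sign * ∫ x, h x * φ x ∂vol a b := by
    rw [← integral_const_mul]
    refine integral_congr_ae ?_
    filter_upwards [ae_mem_Ioo a b] with x hx
    have hx := Ioo_subset_Icc_self hx
    rw [fracInt_fracInt s.opp hα0 hα1 hx hφ.integrable_deriv, hφ.fracInt_one_deriv s.opp hx]
    ring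
  change ∫ x, h x * φ x ∂vol a b = ∫ x, v x * classicalFracDeriv s.opp a b α φ x ∂vol a b
  rw [e1, H.integral_eq, e2, ← mul_assoc, Side.sign_mul_self, one_mul]

/-- Injectivity is uniqueness of weak derivatives: both `h` and `0` are weak derivatives of the zero
function. -/
theorem ae_eq_zero_of_fracInt {s : Side} {a b α : ℝ} (hα0 : 0 < α) (hα1 : α < 1)
    {h : ℝ → ℝ} (hh : Integrable h (vol a b)) (h0 : fracInt s a b α h =ᵐ[vol a b] 0) :
    h =ᵐ[vol a b] 0 := by
  have h1 := isWeakFracDeriv_of_ae_eq_fracInt hα0 hα1 hh h0.symm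
  have h2 : IsWeakFracDeriv s a b α 0 0 := by
    refine isWeakFracDeriv_of_ae_eq_fracInt hα0 hα1 (integrable_zero _ _ _) ?_
    exact Eventually.of_forall fun x => by cases s <;> simp [fracInt]
  exact h1.ae_eq h2


/-! ### Test functions and the lemma of du Bois-Reymond. -/

theorem IsTestFunction.setIntegral_eq {a b : ℝ} {φ : ℝ → ℝ} (hφ : IsTestFunction a b φ)
    (f : ℝ → ℝ) : ∫ x, f x * φ x ∂vol a b = ∫ x, f x * φ x := by
  refine setIntegral_eq_integral_of_forall_compl_eq_zero fun x hx => ?_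
  have : φ x = 0 := by
    by_contra h0
    exact hx (hφ.2.2 (subset_tsupport φ h0))
  simp [this]

theorem IsTestFunction.integrable_mul {a b : ℝ} {φ : ℝ → ℝ} (hφ : IsTestFunction a b φ)
    {f : ℝ → ℝ} (hf : Integrable f (vol a b)) : Integrable (fun x => f x * φ x) (vol a b) := by
  obtain ⟨M, hM⟩ := hφ.1.continuous.bounded_above_of_compact_support hφ.2.1
  exact hf.mul_bdd hφ.1.continuous.aestronglyMeasurable (Eventually.of_forall hM)

theorem IsTestFunction.sub {a b : ℝ} {φ ψ : ℝ → ℝ} (hφ : IsTestFunction a b φ)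
    (hψ : IsTestFunction a b ψ) : IsTestFunction a b (fun x => φ x - ψ x) :=
  ⟨hφ.1.sub hψ.1, hφ.2.1.sub hψ.2.1,
    (tsupport_sub φ ψ).trans (union_subset hφ.2.2 hψ.2.2)⟩

theorem IsTestFunction.const_mul {a b : ℝ} {φ : ℝ → ℝ} (hφ : IsTestFunction a b φ) (c : ℝ) :
    IsTestFunction a b (fun x => c * φ x) :=
  ⟨contDiff_const.mul hφ.1, hφ.2.1.mul_left,
    (closure_mono (Function.support_mul_subset_right (fun _ => c) φ)).trans hφ.2.2⟩

theorem exists_isTestFunction_integral_eq_one {a b : ℝ} (hab : a < b) :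
    ∃ ψ, IsTestFunction a b ψ ∧ ∫ x, ψ x = 1 := by
  let f : ContDiffBump ((a + b) / 2) :=
    { rIn := (b - a) / 8, rOut := (b - a) / 4, rIn_pos := by linarith, rIn_lt_rOut := by linarith }
  refine ⟨f.normed volume, ⟨f.contDiff_normed, f.hasCompactSupport_normed, ?_⟩,
    f.integral_normed⟩
  rw [f.tsupport_normed_eq, Real.closedBall_eq_Icc]
  change Icc ((a + b) / 2 - (b - a) / 4) ((a + b) / 2 + (b - a) / 4) ⊆ Ioo a b
  exact Icc_subset_Ioo (by linarith) (by linarith)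

theorem exists_Icc_subset_Ioo {a b : ℝ} (hab : a < b) {K : Set ℝ} (hK : IsCompact K)
    (hKab : K ⊆ Ioo a b) : ∃ c d, a < c ∧ d < b ∧ K ⊆ Icc c d := by
  rcases K.eq_empty_or_nonempty with rfl | hne
  · exact ⟨(a + b) / 2, (a + b) / 2, by linarith, by linarith, empty_subset _⟩
  · exact ⟨sInf K, sSup K, (hKab (hK.sInf_mem hne)).1, (hKab (hK.sSup_mem hne)).2,
      fun x hx => ⟨csInf_le hK.bddBelow hx, le_csSup hK.bddAbove hx⟩⟩

/-- The primitive from `a` vanishes to the left of the support of `η` trivially, and to its right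
because the mean of `η` is zero. -/
theorem IsTestFunction.exists_primitive {a b : ℝ} (hab : a < b) {η : ℝ → ℝ}
    (hη : IsTestFunction a b η) (h0 : ∫ x, η x = 0) :
    ∃ φ, IsTestFunction a b φ ∧ deriv φ = η := by
  have hc : Continuous η := hη.1.continuous
  have hd : ∀ x, HasDerivAt (fun x => ∫ y in a..x, η y) (η x) x := fun x =>
    intervalIntegral.integral_hasDerivAt_right (hc.intervalIntegrable _ _)
      (hc.stronglyMeasurableAtFilter _ _) hc.continuousAt
  have hderiv : deriv (fun x => ∫ y in a..x, η y) = η := funext fun x => (hd x).deriv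
  obtain ⟨c, d, hac, hdb, hcd⟩ := exists_Icc_subset_Ioo hab hη.2.1 hη.2.2
  have hz : ∀ x, x ∉ Icc c d → η x = 0 := fun x hx => by
    by_contra h
    exact hx (hcd (subset_tsupport η h))
  have hint : ∫ y in a..b, η y = 0 := by
    rw [intervalIntegral.integral_of_le hab.le, ← h0]
    refine setIntegral_eq_integral_of_forall_compl_eq_zero fun x hx => hz x fun hx' => hx ?_
    exact ⟨hac.trans_le hx'.1, (hx'.2.trans_lt hdb).le⟩
  have hsupp : Function.support (fun x => ∫ y in a..x, η y) ⊆ Icc c d := by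
    intro x hx
    by_contra hxcd
    refine hx ?_
    rcases lt_or_ge x c with h | h
    · refine (intervalIntegral.integral_congr (g := fun _ => 0) fun y hy => hz y fun hy' => ?_).trans
        (by simp)
      exact absurd hy'.1 (not_le.2 (hy.2.trans_lt (max_lt hac h)))
    · have h' : d < x := by
        by_contra h1
        exact hxcd ⟨h, not_lt.1 h1⟩
      have : ∫ y in b..x, η y = 0 := by
        refine (intervalIntegral.integral_congr (g := fun _ => 0)
          fun y hy => hz y fun hy' => ?_).trans (by simp)
        exact absurd hy'.2 (not_le.2 ((lt_min hdb h').trans_le hy.1))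
      simp only
      rw [← intervalIntegral.integral_add_adjacent_intervals (hc.intervalIntegrable a b)
        (hc.intervalIntegrable b x), hint, this, add_zero]
  refine ⟨fun x => ∫ y in a..x, η y, ⟨?_, ?_, ?_⟩, hderiv⟩
  · exact contDiff_infty_iff_deriv.2 ⟨fun x => (hd x).differentiableAt, by
      rw [hderiv]; exact hη.1⟩
  · exact HasCompactSupport.of_support_subset_isCompact isCompact_Icc hsupp
  · exact (closure_minimal hsupp isClosed_Icc).trans (Icc_subset_Ioo hac hdb)

/-- The lemma of du Bois-Reymond. -/
theorem ae_eq_const_of_integral_mul_deriv_eq_zero {a b : ℝ} (hab : a < b) {F : ℝ → ℝ}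
    (hF : Integrable F (vol a b))
    (h : ∀ φ, IsTestFunction a b φ → ∫ x, F x * deriv φ x ∂vol a b = 0) :
    ∃ c, ∀ᵐ x ∂vol a b, F x = c := by
  obtain ⟨ψ₀, hψ₀, hψ₀1⟩ := exists_isTestFunction_integral_eq_one hab
  refine ⟨∫ x, F x * ψ₀ x ∂vol a b, ?_⟩
  set c := ∫ x, F x * ψ₀ x ∂vol a b
  have hFc : Integrable (fun x => F x - c) (vol a b) := hF.sub (integrable_const c)
  have hint : ∀ {ψ : ℝ → ℝ}, IsTestFunction a b ψ → Integrable ψ :=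
    fun hψ => hψ.1.continuous.integrable_of_hasCompactSupport hψ.2.1
  have key : ∀ ψ, IsTestFunction a b ψ → ∫ x, (F x - c) * ψ x ∂vol a b = 0 := by
    intro ψ hψ
    -- Removing the mean of `ψ` with the fixed bump `ψ₀` leaves the derivative of a test function.
    have hη := hψ.sub (hψ₀.const_mul (∫ x, ψ x))
    obtain ⟨φ, hφ, hφ'⟩ := hη.exists_primitive hab (by
      rw [integral_sub (hint hψ) ((hint hψ₀).const_mul _), integral_const_mul, hψ₀1, mul_one,
        sub_self])
    have h1 := h φ hφ
    rw [hφ'] at h1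
    have h2 : ∫ x, ψ x ∂vol a b = ∫ x, ψ x := by simpa using hψ.setIntegral_eq (fun _ => 1)
    have h3 : ∫ x, F x * (ψ x - (∫ y, ψ y) * ψ₀ x) ∂vol a b =
        (∫ x, F x * ψ x ∂vol a b) - (∫ y, ψ y) * c := by
      rw [← integral_const_mul, ← integral_sub (hψ.integrable_mul hF)
        ((hψ₀.integrable_mul hF).const_mul _)]
      refine integral_congr_ae (Eventually.of_forall fun x => ?_)
      simp only
      ring
    have h4 : ∫ x, (F x - c) * ψ x ∂vol a b =
        (∫ x, F x * ψ x ∂vol a b) - c * ∫ x, ψ x := by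
      rw [← h2, ← integral_const_mul, ← integral_sub (hψ.integrable_mul hF)
        ((hint hψ).integrableOn.const_mul _)]
      simp only [sub_mul]
    rw [h4, mul_comm, ← h3, h1]
  have : ∀ᵐ x, x ∈ Ioo a b → F x - c = 0 :=
    isOpen_Ioo.ae_eq_zero_of_integral_contDiff_smul_eq_zero
      (IntegrableOn.locallyIntegrableOn hFc) fun φ h1 h2 h3 => by
      have hφ : IsTestFunction a b φ := ⟨h1, h2, h3⟩
      rw [← key φ hφ, hφ.setIntegral_eq]
      simp [mul_comm]
  have : ∀ᵐ x ∂vol a b, F x - c = 0 := (ae_restrict_iff' measurableSet_Ioo).2 this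
  filter_upwards [this] with x hx using sub_eq_zero.1 hx

/-! ### The fundamental theorem of calculus. -/

/-- The trace in direction `s` is taken at the far endpoint, where integration in the opposite
direction starts. -/
theorem traceFilter_le (s : Side) {a b : ℝ} (hab : a < b) :
    traceFilter s a b ≤ 𝓝[Ioo a b] (s.opp.base a b) := by
  cases s
  · exact (nhdsWithin_Ioo_eq_nhdsLT hab).ge
  · exact (nhdsWithin_Ioo_eq_nhdsGT hab).ge

theorem tendsto_fracInt_one (s : Side) {a b : ℝ} (hab : a < b) {h : ℝ → ℝ}
    (hh : Integrable h (vol a b)) :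
    Tendsto (fracInt s a b 1 h) (traceFilter s.opp a b) (𝓝 0) := by
  have hi : IntervalIntegrable h volume a b :=
    (intervalIntegrable_iff_integrableOn_Ioo_of_le hab.le).2 hh
  have hb := s.base_mem hab
  have hcont := intervalIntegral.continuousOn_primitive_interval' hi
    (a := s.base a b) (by rwa [uIcc_of_le hab.le])
  rw [uIcc_of_le hab.le] at hcont
  have h1 := (hcont _ hb).tendsto.const_mul s.sign
  rw [intervalIntegral.integral_same, mul_zero] at h1
  have hf := traceFilter_le s.opp hab
  rw [Side.opp_opp] at hf
  refine (h1.mono_left (hf.trans (nhdsWithin_mono _ Ioo_subset_Icc_self))).congr' ?_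
  filter_upwards [hf self_mem_nhdsWithin] with x hx
  rw [fracInt_one s h (Ioo_subset_Icc_self hx)]

theorem kernel_one_base (s : Side) {a b x : ℝ} (hx : x ∈ Ioo a b) :
    kernel s 1 x (s.base a b) = 1 := by
  cases s
  · simp [kernel, rieszKernel, Side.base, hx.1]
  · simp [kernel, rieszKernel, Side.base, hx.2]

/-- This is the weak form of `(I^(1-α) v)' = ± h`. Integrating by parts on both sides makes `I^(1-α)
v - I^1 h` orthogonal to all derivatives of test functions, hence constant. -/
theorem IsWeakFracDeriv.exists_ae_eq_fracInt_one {s : Side} {a b α : ℝ} (hab : a < b)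
    (hα1 : α < 1) {v h : ℝ → ℝ} (hv : IsWeakFracDeriv s a b α v h) (hh : Integrable h (vol a b)) :
    ∃ c, fracInt s a b (1 - α) v =ᵐ[vol a b] fun x => c + fracInt s a b 1 h x := by
  have hα' : 0 < 1 - α := sub_pos.2 hα1
  have hv1 : Integrable v (vol a b) := hv.1
  have hI := integrable_fracInt s hα' hv1
  have hI1 := integrable_fracInt s one_pos hh
  have key : ∀ φ, IsTestFunction a b φ →
      ∫ x, (fracInt s a b (1 - α) v x - fracInt s a b 1 h x) * deriv φ x ∂vol a b = 0 := by
    intro φ hφ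
    obtain ⟨M, hM⟩ := hφ.deriv_bounded
    have hφm : AEStronglyMeasurable (deriv φ) (vol a b) := hφ.integrable_deriv.1
    have d1 := (kernelIntegrable_of_bounded_left (s := s) hα' hφm (fun x _ => hM x) hv1)
    have d2 := (kernelIntegrable_of_bounded_left (s := s) one_pos hφm (fun x _ => hM x) hh)
    have e1 : ∫ x, fracInt s.opp a b (1 - α) (deriv φ) x * v x ∂vol a b =
        s.opp.sign * ∫ x, v x * classicalFracDeriv s.opp a b α φ x ∂vol a b := by
      rw [← integral_const_mul]
      refine integral_congr_ae (Eventually.of_forall fun x => ?_)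
      simp only [classicalFracDeriv_eq]
      linear_combination (-fracInt s.opp a b (1 - α) (deriv φ) x * v x) * s.opp.sign_mul_self
    have e2 : ∫ x, fracInt s.opp a b 1 (deriv φ) x * h x ∂vol a b =
        s.opp.sign * ∫ x, h x * φ x ∂vol a b := by
      rw [← integral_const_mul]
      refine integral_congr_ae ?_
      filter_upwards [ae_mem_Ioo a b] with x hx
      rw [hφ.fracInt_one_deriv s.opp (Ioo_subset_Icc_self hx)]
      ring
    have e3 : ∫ x, h x * φ x ∂vol a b = ∫ x, v x * classicalFracDeriv s.opp a b α φ x ∂vol a b :=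
      hv.2.2 φ hφ
    have d3 := d1.integral_eq
    have d4 := d2.integral_eq
    rw [e1, ← e3, ← e2, ← d4] at d3
    calc _ = ∫ x, (deriv φ x * fracInt s a b (1 - α) v x - deriv φ x * fracInt s a b 1 h x)
          ∂vol a b := by
          refine integral_congr_ae (Eventually.of_forall fun x => ?_)
          simp only
          ring
      _ = 0 := by rw [integral_sub d1.integrable d2.integrable, d3, sub_self]
  obtain ⟨c, hc⟩ := ae_eq_const_of_integral_mul_deriv_eq_zero hab (hI.sub hI1) key
  refine ⟨c, ?_⟩
  filter_upwards [hc] with x hx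
  simp only [Pi.sub_apply] at hx
  linarith

/-- The fundamental theorem of calculus for weak fractional derivatives. -/
theorem IsWeakFracDeriv.exists_ae_eq {s : Side} {a b α : ℝ} (hab : a < b) (hα0 : 0 < α)
    (hα1 : α < 1) {v h : ℝ → ℝ} (hv : IsWeakFracDeriv s a b α v h) (hh : Integrable h (vol a b)) :
    ∃ c, v =ᵐ[vol a b] (fun x => c * kernel s α x (s.base a b) + fracInt s a b α h x) ∧
      HasTrace s.opp a b (fracInt s a b (1 - α) v) c := by
  obtain ⟨c, hc⟩ := hv.exists_ae_eq_fracInt_one hab hα1 hh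
  -- The representative `c + I^1 h` tends to `c` at the base point, which identifies `c` as a trace.
  refine ⟨c, ?_, fun x => c + fracInt s a b 1 h x, hc.symm, ?_⟩
  swap
  · simpa using (tendsto_fracInt_one s hab hh).const_add c
  have hα' : 0 < 1 - α := sub_pos.2 hα1
  have hv1 : Integrable v (vol a b) := hv.1
  have hb := s.base_mem hab
  have hk : Integrable (fun x => -c * kernel s α x (s.base a b)) (vol a b) :=
    (integrable_kernel_left s hα0 hb).const_mul _
  have hIh : Integrable (fun x => -1 * fracInt s a b α h x) (vol a b) :=
    (integrable_fracInt s hα0 hh).const_mul _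
  -- `I^(1-α)` annihilates `v - c k_α - I^α h`: its values on the three terms are `c + I^1 h`, `-c`
  -- and `-I^1 h`.
  have h0 := ae_eq_zero_of_fracInt (s := s) hα' (by linarith : 1 - α < 1)
    (hv1.add (hk.add hIh)) (by
      have a1 := fracInt_add_ae s hα' hv1 (hk.add hIh)
      have a2 := fracInt_add_ae s hα' hk hIh
      filter_upwards [ae_mem_Ioo a b, a1, a2, hc] with x hx h1 h2 h3
      have hx' := Ioo_subset_Icc_self hx
      have e1 := fracInt_kernel s hα' (by linarith : 1 - α < 1) hx' hb
      have e2 := fracInt_fracInt s hα' (by linarith : 1 - α < 1) hx' hh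
      rw [sub_sub_cancel] at e1 e2
      rw [kernel_one_base s hx] at e1
      refine h1.trans ?_
      rw [h3]
      refine (congrArg _ h2).trans ?_
      rw [fracInt_const_mul, fracInt_const_mul, e1, e2, Pi.zero_apply]
      ring)
  filter_upwards [h0] with x hx
  simp only [Pi.add_apply, Pi.zero_apply] at hx
  linarith


/-! ### Green's identity from the two representations. -/

/-- The kernel coefficient of the flux in the opposite direction is by definition the Neumann value,
so that value exists automatically. -/
theorem HasFracLaplacian.exists_flux_ae_eq {s : Side} {a b α p : ℝ} (hab : a < b) (hα0 : 0 < α)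
    (hα1 : α < 1) {u : ℝ → ℝ} (hu : HasFracLaplacian s a b α p u)
    (hi : IntegrableOn (fracLaplacian s a b α p u) (Ioo a b)) :
    ∃ n, flux s a b α p u =ᵐ[vol a b] (fun x => n * kernel s.opp α x (s.opp.base a b) +
      fracInt s.opp a b α (fracLaplacian s a b α p u) x) ∧ HasNeumann s a b α p u n := by
  have := (isWeakFracDeriv_weakFracDeriv hu).exists_ae_eq hab hα0 hα1 hi
  rwa [Side.opp_opp] at this

/-- The kernel part of the flux, tested with `h`, produces the boundary term; the rest is
integration by parts. The factor `n` stays inside `hnt` and `hnt'` so that for `n = 0` nothing is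
asked of the boundary integral. -/
theorem greenIdentity_of_ae_eq {s : Side} {a b α p : ℝ} (hα0 : 0 < α) (hα1 : α < 1)
    {u v h : ℝ → ℝ} {n t : ℝ}
    (hw : flux s a b α p u =ᵐ[vol a b] (fun x => n * kernel s.opp α x (s.opp.base a b) +
      fracInt s.opp a b α (fracLaplacian s a b α p u) x))
    (hn : HasNeumann s a b α p u n)
    (hh : Integrable h (vol a b)) (hv : v =ᵐ[vol a b] fracInt s a b α h)
    (H : KernelIntegrable s a b α (fracLaplacian s a b α p u) h)
    (ht : HasTrace s a b v t)
    (hnt : Integrable (fun y => n * (kernel s α (s.opp.base a b) y * h y)) (vol a b))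
    (hnt' : ∫ y, n * (kernel s α (s.opp.base a b) y * h y) ∂vol a b = n * t) :
    GreenIdentity s a b α p u v := by
  have hvh := isWeakFracDeriv_of_ae_eq_fracInt hα0 hα1 hh hv
  have hex : HasWeakFracDeriv s a b α v := ⟨h, hvh⟩
  have hD : weakFracDeriv s a b α v =ᵐ[vol a b] h :=
    (isWeakFracDeriv_weakFracDeriv hex).ae_eq hvh
  have e1 : (fun x => flux s a b α p u x * weakFracDeriv s a b α v x) =ᵐ[vol a b]
      fun x => h x * fracInt s.opp a b α (fracLaplacian s a b α p u) x +
        n * (kernel s α (s.opp.base a b) x * h x) := by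
    filter_upwards [hw, hD] with x h1 h2
    rw [h1, h2, kernel_opp]
    ring
  have e2 : (fun x => fracLaplacian s a b α p u x * v x) =ᵐ[vol a b]
      fun x => fracLaplacian s a b α p u x * fracInt s a b α h x := by
    filter_upwards [hv] with x h1
    rw [h1]
  have H' := H.swap
  refine ⟨hex, (H'.integrable.add hnt).congr e1.symm, H.integrable.congr e2.symm, n, t, hn, ht, ?_⟩
  change ∫ x, _ ∂vol a b = (∫ x, _ ∂vol a b) + _
  rw [integral_congr_ae e1, integral_congr_ae e2, integral_add H'.integrable hnt, hnt', H.integral_eq]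
  congr 1
  exact integral_congr_ae (Eventually.of_forall fun x => mul_comm _ _)

theorem integrable_kernel_mul_of_bound {s : Side} {a b β x : ℝ} (hβ : 0 < β) {h : ℝ → ℝ}
    (hh : AEStronglyMeasurable h (vol a b)) {C : ENNReal} (hC : C ≠ ⊤)
    (H : ∫⁻ y, ENNReal.ofReal (kernel s β x y) * ‖h y‖ₑ ∂vol a b ≤ C) :
    Integrable (fun y => kernel s β x y * h y) (vol a b) := by
  refine ⟨(measurable_kernel_right s β x).aestronglyMeasurable.mul hh, ?_⟩
  simpa only [HasFiniteIntegral, enorm_mul, enorm_kernel s hβ] using H.trans_lt hC.lt_top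

/-- The uniform bound is used twice: at interior points for Fubini, and at the far endpoint to make
the boundary integral converge to `n` times the value of `I^α h` there. -/
theorem greenIdentity_of_bound {s : Side} {a b α p : ℝ} (hab : a < b) (hα0 : 0 < α) (hα1 : α < 1)
    {u v h : ℝ → ℝ} (hu : HasFracLaplacian s a b α p u)
    (hi : IntegrableOn (fracLaplacian s a b α p u) (Ioo a b))
    (hh : Integrable h (vol a b)) (hv : v =ᵐ[vol a b] fracInt s a b α h)
    {C : ENNReal} (hC : C ≠ ⊤)
    (H : ∀ x ∈ Icc a b, ∫⁻ y, ENNReal.ofReal (kernel s α x y) * ‖h y‖ₑ ∂vol a b ≤ C)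
    (ht : HasTrace s a b v (fracInt s a b α h (s.opp.base a b))) :
    GreenIdentity s a b α p u v := by
  obtain ⟨n, hw, hn⟩ := hu.exists_flux_ae_eq hab hα0 hα1 hi
  have he := s.opp.base_mem hab
  refine greenIdentity_of_ae_eq hα0 hα1 hw hn hh hv
    (kernelIntegrable_of_bound hα0 hi hh.1 hC fun x hx => H x (Ioo_subset_Icc_self hx)) ht
    ((integrable_kernel_mul_of_bound hα0 hh.1 hC (H _ he)).const_mul n) ?_
  rw [integral_const_mul, fracInt_eq s α h he]

/-! ### Test functions that are smooth up to the boundary. -/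

theorem integral_derivWithin_eq_sub {a b : ℝ} (hab : a < b) {v : ℝ → ℝ}
    (hv : ContDiffOn ℝ ∞ v (Icc a b)) {x y : ℝ} (hx : x ∈ Icc a b) (hy : y ∈ Icc a b) :
    ∫ t in x..y, derivWithin v (Icc a b) t = v y - v x := by
  have hsub : uIcc x y ⊆ Icc a b := uIcc_subset_Icc hx hy
  have hd := hv.continuousOn_derivWithin (uniqueDiffOn_Icc hab) (by simp)
  refine intervalIntegral.integral_eq_sub_of_hasDeriv_right (hv.continuousOn.mono hsub)
    (fun t ht => ?_) (hd.mono hsub).intervalIntegrable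
  have ht' : t ∈ Ioo a b := by
    constructor
    · exact (le_min hx.1 hy.1).trans_lt ht.1
    · exact ht.2.trans_le (max_le hx.2 hy.2)
  have hda : DifferentiableAt ℝ v t :=
    (hv.differentiableOn (by simp)).differentiableAt (Icc_mem_nhds ht'.1 ht'.2)
  rw [derivWithin_of_mem_nhds (Icc_mem_nhds ht'.1 ht'.2)]
  exact hda.hasDerivAt.hasDerivWithinAt

/-- The weak fractional derivative of a function that is smooth up to the boundary, and the bound
that makes Green's identity work although it need not be in the energy space. -/
theorem exists_fracInt_of_contDiffOn (s : Side) {a b α : ℝ} (hab : a < b) (hα0 : 0 < α)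
    (hα1 : α < 1) {v : ℝ → ℝ} (hv : ContDiffOn ℝ ∞ v (Icc a b)) :
    ∃ h, Integrable h (vol a b) ∧
      (∃ C : ENNReal, C ≠ ⊤ ∧ ∀ x ∈ Icc a b,
        ∫⁻ y, ENNReal.ofReal (kernel s α x y) * ‖h y‖ₑ ∂vol a b ≤ C) ∧
      (∀ x ∈ Ioo a b, fracInt s a b α h x = v x) ∧
      fracInt s a b α h (s.opp.base a b) = v (s.opp.base a b) := by
  have hα' : 0 < 1 - α := sub_pos.2 hα1
  have hb := s.base_mem hab
  set e := s.base a b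
  set v' := derivWithin v (Icc a b)
  have hd : ContinuousOn v' (Icc a b) :=
    hv.continuousOn_derivWithin (uniqueDiffOn_Icc hab) (by simp)
  obtain ⟨M, hM⟩ := isCompact_Icc.exists_bound_of_continuousOn hd
  have hM' : ∀ x ∈ Ioo a b, |v' x| ≤ M := fun x hx => hM x (Ioo_subset_Icc_self hx)
  have hv'i : Integrable v' (vol a b) := integrable_of_bounded
    ((hd.mono Ioo_subset_Icc_self).aestronglyMeasurable measurableSet_Ioo) hM'
  obtain ⟨C, hC⟩ := exists_fracInt_bound s hα' hM'
  have hC' : ∀ x ∈ Ioo a b, |s.sign * fracInt s a b (1 - α) v' x| ≤ C := fun x hx => by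
    have := hC x (Ioo_subset_Icc_self hx)
    cases s <;> simpa [Side.sign] using this
  have i1 : Integrable (fun y => v e * kernel s (1 - α) y e) (vol a b) :=
    (integrable_kernel_left s hα' hb).const_mul _
  have i2 : Integrable (fun y => s.sign * fracInt s a b (1 - α) v' y) (vol a b) :=
    (integrable_fracInt s hα' hv'i).const_mul _
  -- The singular part of `h` need not lie in `L^p`, but against `kernel s α` it integrates to at
  -- most the order-one kernel.
  have b1 : ∀ x ∈ Icc a b, ∫⁻ y, ENNReal.ofReal (kernel s α x y) *
      ‖v e * kernel s (1 - α) y e‖ₑ ∂vol a b ≤ ‖v e‖ₑ := fun x hx => by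
    simp only [enorm_mul, mul_left_comm _ ‖v e‖ₑ]
    rw [lintegral_const_mul' _ _ enorm_ne_top]
    exact mul_le_of_le_one_right' (kernel_kernel_bound s hα0 hα1 hx hb)
  have b2 := fun x (hx : x ∈ Icc a b) => lintegral_kernel_mul_le s hα0 hx hC'
  -- The order-one kernel is `1` except at `x = e`, where it is `0` and the boundary value `v e`
  -- would be lost.
  have hval : ∀ x ∈ Icc a b, kernel s 1 x e = 1 → fracInt s a b α
      (fun y => v e * kernel s (1 - α) y e + s.sign * fracInt s a b (1 - α) v' y) x = v x := by
    intro x hx h1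
    have j1 := integrable_kernel_mul_of_bound hα0 i1.1 enorm_ne_top (b1 x hx)
    have j2 := integrable_kernel_mul_of_bound hα0 i2.1 (by finiteness) (b2 x hx)
    have : fracInt s a b α
        (fun y => v e * kernel s (1 - α) y e + s.sign * fracInt s a b (1 - α) v' y) x =
        fracInt s a b α (fun y => v e * kernel s (1 - α) y e) x +
          fracInt s a b α (fun y => s.sign * fracInt s a b (1 - α) v' y) x := by
      simp only [fracInt_eq s α _ hx]
      rw [← integral_add j1 j2]
      simp only [mul_add]
    rw [this, fracInt_const_mul, fracInt_const_mul, fracInt_kernel s hα0 hα1 hx hb, h1,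
      fracInt_fracInt s hα0 hα1 hx hv'i, fracInt_one s _ hx, integral_derivWithin_eq_sub hab hv hb hx]
    linear_combination (v x - v e) * s.sign_mul_self
  -- The witness is the Riemann-Liouville derivative of `v`: the Caputo derivative plus the
  -- contribution of the boundary value at `e`.
  refine ⟨fun y => v e * kernel s (1 - α) y e + s.sign * fracInt s a b (1 - α) v' y, i1.add i2,
    ⟨‖v e‖ₑ + ENNReal.ofReal ((Real.Gamma α)⁻¹ * ((b - a) ^ α / α)) * ENNReal.ofReal C,
      by finiteness, fun x hx => ?_⟩,
    fun x hx => hval x (Ioo_subset_Icc_self hx) (kernel_one_base s hx),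
    hval _ (s.opp.base_mem hab) ?_⟩
  · calc _ ≤ ∫⁻ y, (ENNReal.ofReal (kernel s α x y) * ‖v e * kernel s (1 - α) y e‖ₑ +
          ENNReal.ofReal (kernel s α x y) * ‖s.sign * fracInt s a b (1 - α) v' y‖ₑ) ∂vol a b := by
          refine lintegral_mono fun y => ?_
          rw [← mul_add]
          gcongr
          exact enorm_add_le _ _
      _ ≤ _ := by
          rw [lintegral_add_left']
          · exact add_le_add (b1 x hx) (b2 x hx)
          · exact (measurable_kernel_right s α x).ennreal_ofReal.aemeasurable.mul i1.1.enorm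
  · cases s
    · simp [kernel, rieszKernel, Side.base, Side.opp, e, hab]
    · simp [kernel, rieszKernel, Side.base, Side.opp, e, hab]

theorem greenIdentity_of_contDiffOn {s : Side} {a b α p : ℝ} (hab : a < b) (hα0 : 0 < α)
    (hα1 : α < 1) {u v : ℝ → ℝ} (hu : HasFracLaplacian s a b α p u)
    (hi : IntegrableOn (fracLaplacian s a b α p u) (Ioo a b))
    (hv : ContDiffOn ℝ ∞ v (Icc a b)) : GreenIdentity s a b α p u v := by
  obtain ⟨h, hh, ⟨C, hC, hC'⟩, h1, h2⟩ := exists_fracInt_of_contDiffOn s hab hα0 hα1 hv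
  refine greenIdentity_of_bound hab hα0 hα1 hu hi hh ?_ hC hC' ?_
  · filter_upwards [ae_mem_Ioo a b] with x hx using (h1 x hx).symm
  · rw [h2]
    exact ⟨v, EventuallyEq.rfl, ((hv.continuousOn _ (s.opp.base_mem hab)).mono
      Ioo_subset_Icc_self).tendsto.mono_left (traceFilter_le s hab)⟩

/-! ### The case `αp > 1`: continuity of fractional integrals at the far endpoint. -/

/-- The kernel coefficient and `0` are traces of the same function, so uniqueness of traces removes
the kernel term. -/
theorem exists_fracInt_of_mem_fracSobolevRing {s : Side} {a b α p : ℝ} (hab : a < b) (hα0 : 0 < α)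
    (hα1 : α < 1) (hp : 1 < p) {v : ℝ → ℝ} (hv : v ∈ fracSobolevRing s a b α p) :
    ∃ h, Integrable h (vol a b) ∧ MemLp h (ENNReal.ofReal p) (vol a b) ∧
      v =ᵐ[vol a b] fracInt s a b α h := by
  obtain ⟨⟨_, hex, hmem⟩, htr⟩ := hv
  have hi : Integrable (weakFracDeriv s a b α v) (vol a b) :=
    hmem.integrable (by rw [← ENNReal.ofReal_one]; exact ENNReal.ofReal_le_ofReal hp.le)
  refine ⟨_, hi, hmem, ?_⟩
  obtain ⟨c, hc, hct⟩ := (isWeakFracDeriv_weakFracDeriv hex).exists_ae_eq hab hα0 hα1 hi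
  have : c = 0 := hct.unique hab htr
  simpa [this] using hc

/-- Dominated convergence with a convergent family of dominating functions. -/
theorem tendsto_integral_of_dominated_family {ι X : Type*} [MeasurableSpace X] {μ : Measure X}
    {l : Filter ι} [l.IsCountablyGenerated] {f F : ι → X → ℝ} {f₀ F₀ : X → ℝ}
    (hf : ∀ᶠ i in l, AEStronglyMeasurable (f i) μ) (hf₀ : Integrable f₀ μ)
    (hF : ∀ᶠ i in l, Integrable (F i) μ) (hF₀ : Integrable F₀ μ)
    (hle : ∀ᶠ i in l, ∀ᵐ x ∂μ, |f i x| ≤ F i x) (hle₀ : ∀ᵐ x ∂μ, |f₀ x| ≤ F₀ x)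
    (hft : ∀ᵐ x ∂μ, Tendsto (fun i => f i x) l (𝓝 (f₀ x)))
    (hFt : ∀ᵐ x ∂μ, Tendsto (fun i => F i x) l (𝓝 (F₀ x)))
    (hint : Tendsto (fun i => ∫ x, F i x ∂μ) l (𝓝 (∫ x, F₀ x ∂μ))) :
    Tendsto (fun i => ∫ x, f i x ∂μ) l (𝓝 (∫ x, f₀ x ∂μ)) := by
  -- Truncation at `2 F₀` supplies a fixed dominating function; this limit plays the role of Fatou's
  -- lemma for the nonnegative functions `F i + F₀ - |f i - f₀|`.
  have hmin : Tendsto (fun i => ∫ x, min (F i x + F₀ x - |f i x - f₀ x|) (2 * F₀ x) ∂μ) l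
      (𝓝 (∫ x, 2 * F₀ x ∂μ)) := by
    refine tendsto_integral_filter_of_dominated_convergence (fun x => 2 * F₀ x) ?_ ?_
      (hF₀.const_mul 2) ?_
    · filter_upwards [hf, hF] with i h1 h2
      exact ((h2.1.add hF₀.1).sub (h1.sub hf₀.1).norm).inf (hF₀.const_mul 2).1
    · filter_upwards [hle] with i hi
      filter_upwards [hi, hle₀] with x h1 h2
      have h3 : |f i x - f₀ x| ≤ |f i x| + |f₀ x| := abs_sub _ _
      have h4 := abs_nonneg (f₀ x)
      rw [Real.norm_of_nonneg (le_min (by linarith) (by linarith))]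
      exact min_le_right _ _
    · filter_upwards [hft, hFt] with x h1 h2
      have h3 : Tendsto (fun i => F i x + F₀ x - |f i x - f₀ x|) l
          (𝓝 (F₀ x + F₀ x - |f₀ x - f₀ x|)) :=
        (h2.add_const _).sub (h1.sub_const _).abs
      have h4 := h3.min (tendsto_const_nhds (x := 2 * F₀ x))
      rwa [sub_self, abs_zero, sub_zero, ← two_mul, min_self] at h4
  have hup : Tendsto (fun i => (∫ x, F i x ∂μ) + (∫ x, F₀ x ∂μ) -
      ∫ x, min (F i x + F₀ x - |f i x - f₀ x|) (2 * F₀ x) ∂μ) l (𝓝 0) := by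
    have := (hint.add_const (∫ x, F₀ x ∂μ)).sub hmin
    rwa [integral_const_mul, ← two_mul, sub_self] at this
  rw [tendsto_iff_norm_sub_tendsto_zero]
  refine squeeze_zero' (Eventually.of_forall fun i => norm_nonneg _) ?_ hup
  filter_upwards [hf, hF, hle] with i h1 h2 h3
  have hfi : Integrable (f i) μ := h2.mono' h1 h3
  have hd : Integrable (fun x => |f i x - f₀ x|) μ := (hfi.sub hf₀).abs
  have hG : Integrable (fun x => F i x + F₀ x - |f i x - f₀ x|) μ := (h2.add hF₀).sub hd
  have e : ∫ x, (F i x + F₀ x - |f i x - f₀ x|) ∂μ =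
      (∫ x, F i x ∂μ) + (∫ x, F₀ x ∂μ) - ∫ x, |f i x - f₀ x| ∂μ := by
    have hs : Integrable (fun x => F i x + F₀ x) μ := h2.add hF₀
    rw [integral_sub hs hd, integral_add h2 hF₀]
  have h5 : ∫ x, min (F i x + F₀ x - |f i x - f₀ x|) (2 * F₀ x) ∂μ ≤
      ∫ x, (F i x + F₀ x - |f i x - f₀ x|) ∂μ :=
    integral_mono (hG.inf (hF₀.const_mul 2)) hG fun x => min_le_left _ _
  have h6 : ‖(∫ x, f i x ∂μ) - ∫ x, f₀ x ∂μ‖ ≤ ∫ x, |f i x - f₀ x| ∂μ := by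
    rw [← integral_sub hfi hf₀]
    exact norm_integral_le_integral_norm _
  linarith

theorem tendsto_kernel (s : Side) {a b β y : ℝ} (hab : a < b) (hy : y ∈ Ioo a b) :
    Tendsto (fun x => kernel s β x y) (traceFilter s a b) (𝓝 (kernel s β (s.opp.base a b) y)) := by
  have hc : ∀ {t : ℝ}, 0 < t → ContinuousAt (rieszKernel β) t := fun {t} ht => by
    have : ContinuousAt (fun t : ℝ => (Real.Gamma β)⁻¹ * t ^ (β - 1)) t :=
      (Real.continuousAt_rpow_const _ _ (Or.inl ht.ne')).const_mul _
    refine this.congr ?_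
    filter_upwards [lt_mem_nhds ht] with r hr
    simp [rieszKernel, hr]
  refine Tendsto.mono_left ?_ ((traceFilter_le s hab).trans nhdsWithin_le_nhds)
  cases s
  · exact ContinuousAt.comp' (f := fun x => x - y) (hc (sub_pos.2 hy.2)) (by fun_prop)
  · exact ContinuousAt.comp' (f := fun x => y - x) (hc (sub_pos.2 hy.1)) (by fun_prop)

/-- A power of a Riesz kernel is a multiple of another one, so its integral is already known. For `q
= p/(p-1)` the new order is positive exactly when `αp > 1`. -/
theorem rieszKernel_rpow {α q : ℝ} (hα0 : 0 < α) (hq : 0 < q) (hγ : 0 < (α - 1) * q + 1) (t : ℝ) :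
    rieszKernel α t ^ q = (Real.Gamma α)⁻¹ ^ q * Real.Gamma ((α - 1) * q + 1) *
      rieszKernel ((α - 1) * q + 1) t := by
  have hG := (Real.Gamma_pos_of_pos hγ).ne'
  have hGα := Real.Gamma_pos_of_pos hα0
  unfold rieszKernel
  split_ifs with h
  · rw [Real.mul_rpow (by positivity) (by positivity), ← Real.rpow_mul h.le, add_sub_cancel_right]
    field_simp
  · simp [hq.ne']

theorem integral_kernel (s : Side) {a b β x : ℝ} (hβ : 0 < β) (hx : x ∈ Icc a b) :
    ∫ y, kernel s β x y ∂vol a b = (Real.Gamma β)⁻¹ * (|x - s.base a b| ^ β / β) := by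
  have := Real.Gamma_pos_of_pos hβ
  rw [integral_eq_lintegral_of_nonneg_ae (Eventually.of_forall (kernel_nonneg s hβ x))
    (measurable_kernel_right s β x).aestronglyMeasurable, lintegral_kernel s hβ hx,
    ENNReal.toReal_ofReal (by positivity)]


theorem holderConjugate_div {p : ℝ} (hp : 1 < p) : (p / (p - 1)).HolderConjugate p :=
  (Real.HolderConjugate.conjExponent hp).symm

theorem integrable_abs_rpow {a b q : ℝ} (hq : 0 < q) {f : ℝ → ℝ}
    (hf : MemLp f (ENNReal.ofReal q) (vol a b)) : Integrable (fun x => |f x| ^ q) (vol a b) := by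
  have := hf.integrable_norm_rpow (by simpa using hq) ENNReal.ofReal_ne_top
  simpa only [ENNReal.toReal_ofReal hq.le, Real.norm_eq_abs] using this

instance isCountablyGenerated_traceFilter (s : Side) (a b : ℝ) :
    (traceFilter s a b).IsCountablyGenerated := by
  cases s <;> (unfold traceFilter; infer_instance)

theorem kernel_mul_le {s : Side} {α p q : ℝ} (hα0 : 0 < α) (hpq : q.HolderConjugate p)
    (hγ : 0 < (α - 1) * q + 1) (x y r : ℝ) :
    kernel s α x y * |r| ≤ (Real.Gamma α)⁻¹ ^ q * Real.Gamma ((α - 1) * q + 1) / q *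
      kernel s ((α - 1) * q + 1) x y + |r| ^ p / p := by
  have h : kernel s α x y ^ q = (Real.Gamma α)⁻¹ ^ q * Real.Gamma ((α - 1) * q + 1) *
      kernel s ((α - 1) * q + 1) x y := by
    cases s <;> exact rieszKernel_rpow hα0 hpq.pos hγ _
  have := Real.young_inequality_of_nonneg (kernel_nonneg s hα0 x y) (abs_nonneg r) hpq
  rw [h] at this
  refine this.trans (le_of_eq ?_)
  ring

theorem integrable_kernel_right (s : Side) {β : ℝ} (hβ : 0 < β) {a b x : ℝ} (hx : x ∈ Icc a b) :
    Integrable (kernel s β x) (vol a b) := by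
  simpa only [kernel_opp] using integrable_kernel_left s.opp hβ hx

/-- The singularity moves with `x`, so the majorant from Young's inequality must depend on `x`. Its
integral is an explicit continuous function of `x`, as convergence with varying majorants requires.
-/
theorem tendsto_fracInt_of_memLp {s : Side} {a b α p q : ℝ} (hab : a < b) (hα0 : 0 < α)
    (hpq : q.HolderConjugate p) (hγ : 0 < (α - 1) * q + 1) {h : ℝ → ℝ}
    (hh : MemLp h (ENNReal.ofReal p) (vol a b)) :
    Tendsto (fracInt s a b α h) (traceFilter s a b) (𝓝 (fracInt s a b α h (s.opp.base a b))) := by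
  have hp := hpq.symm.pos
  set γ := (α - 1) * q + 1
  set c := (Real.Gamma α)⁻¹ ^ q * Real.Gamma γ / q
  have hH : Integrable (fun y => |h y| ^ p / p) (vol a b) := (integrable_abs_rpow hp hh).div_const p
  have he := s.opp.base_mem hab
  have hmem : ∀ᶠ x in traceFilter s a b, x ∈ Icc a b :=
    (traceFilter_le s hab).trans (nhdsWithin_mono _ Ioo_subset_Icc_self) self_mem_nhdsWithin
  have hk : ∀ x ∈ Icc a b, Integrable (fun y => c * kernel s γ x y) (vol a b) := fun x hx =>
    (integrable_kernel_right s hγ hx).const_mul c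
  have hF : ∀ x ∈ Icc a b, Integrable (fun y => c * kernel s γ x y + |h y| ^ p / p) (vol a b) :=
    fun x hx => (hk x hx).add hH
  have hFi : ∀ x ∈ Icc a b, ∫ y, (c * kernel s γ x y + |h y| ^ p / p) ∂vol a b =
      c * ((Real.Gamma γ)⁻¹ * (|x - s.base a b| ^ γ / γ)) + ∫ y, |h y| ^ p / p ∂vol a b :=
    fun x hx => by
      rw [integral_add (hk x hx) hH, integral_const_mul, integral_kernel s hγ hx]
  have hfm : ∀ x, AEStronglyMeasurable (fun y => kernel s α x y * h y) (vol a b) := fun x =>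
    (measurable_kernel_right s α x).aestronglyMeasurable.mul hh.1
  have hle : ∀ x y, |kernel s α x y * h y| ≤ c * kernel s γ x y + |h y| ^ p / p := fun x y => by
    rw [abs_mul, abs_of_nonneg (kernel_nonneg s hα0 x y)]
    exact kernel_mul_le hα0 hpq hγ x y (h y)
  rw [fracInt_eq s α h he]
  refine Tendsto.congr' (f₁ := fun x => ∫ y, kernel s α x y * h y ∂vol a b) ?_ ?_
  · filter_upwards [hmem] with x hx
    rw [fracInt_eq s α h hx]
  refine tendsto_integral_of_dominated_family
    (F := fun x y => c * kernel s γ x y + |h y| ^ p / p)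
    (F₀ := fun y => c * kernel s γ (s.opp.base a b) y + |h y| ^ p / p)
    (Eventually.of_forall hfm)
    ((hF _ he).mono' (hfm _) (Eventually.of_forall (hle _))) (hmem.mono hF) (hF _ he)
    (Eventually.of_forall fun x => Eventually.of_forall (hle x))
    (Eventually.of_forall (hle _)) ?_ ?_ ?_
  · filter_upwards [ae_mem_Ioo a b] with y hy
    exact (tendsto_kernel s hab hy).mul_const _
  · filter_upwards [ae_mem_Ioo a b] with y hy
    exact ((tendsto_kernel s hab hy).const_mul _).add_const _
  · rw [hFi _ he]
    refine Tendsto.congr' (hmem.mono fun x hx => (hFi x hx).symm) ?_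
    have hcont : Continuous fun x : ℝ =>
        c * ((Real.Gamma γ)⁻¹ * (|x - s.base a b| ^ γ / γ)) + ∫ y, |h y| ^ p / p ∂vol a b := by
      have : Continuous fun x : ℝ => |x - s.base a b| ^ γ :=
        (by fun_prop : Continuous fun x : ℝ => |x - s.base a b|).rpow_const fun _ => Or.inr hγ.le
      fun_prop
    exact (hcont.tendsto _).mono_left ((traceFilter_le s hab).trans nhdsWithin_le_nhds)

theorem exists_lintegral_bound_of_memLp (s : Side) {a b α p q : ℝ} (hα0 : 0 < α)
    (hpq : q.HolderConjugate p) (hγ : 0 < (α - 1) * q + 1) {h : ℝ → ℝ}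
    (hh : MemLp h (ENNReal.ofReal p) (vol a b)) :
    ∃ C : ENNReal, C ≠ ⊤ ∧ ∀ x ∈ Icc a b,
      ∫⁻ y, ENNReal.ofReal (kernel s α x y) * ‖h y‖ₑ ∂vol a b ≤ C := by
  have hp := hpq.symm.pos
  have hq := hpq.pos
  have hG := Real.Gamma_pos_of_pos hγ
  have hGα := Real.Gamma_pos_of_pos hα0
  set γ := (α - 1) * q + 1
  set c := (Real.Gamma α)⁻¹ ^ q * Real.Gamma γ / q
  have hc : 0 ≤ c := by positivity
  have hH : Integrable (fun y => |h y| ^ p / p) (vol a b) := (integrable_abs_rpow hp hh).div_const p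
  have hHfin : ∫⁻ y, ENNReal.ofReal (|h y| ^ p / p) ∂vol a b ≠ ⊤ := by
    have := hH.2
    rw [hasFiniteIntegral_iff_ofReal (Eventually.of_forall fun y => by positivity)] at this
    exact this.ne
  refine ⟨ENNReal.ofReal c * ENNReal.ofReal ((Real.Gamma γ)⁻¹ * ((b - a) ^ γ / γ)) +
    ∫⁻ y, ENNReal.ofReal (|h y| ^ p / p) ∂vol a b, by finiteness, fun x hx => ?_⟩
  calc _ ≤ ∫⁻ y, (ENNReal.ofReal c * ENNReal.ofReal (kernel s γ x y) +
        ENNReal.ofReal (|h y| ^ p / p)) ∂vol a b := by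
        refine lintegral_mono fun y => ?_
        have hk := kernel_nonneg s hγ x y
        rw [← ofReal_norm, Real.norm_eq_abs, ← ENNReal.ofReal_mul (kernel_nonneg s hα0 x y),
          ← ENNReal.ofReal_mul hc, ← ENNReal.ofReal_add (by positivity) (by positivity)]
        exact ENNReal.ofReal_le_ofReal (kernel_mul_le hα0 hpq hγ x y (h y))
    _ = ENNReal.ofReal c * (∫⁻ y, ENNReal.ofReal (kernel s γ x y) ∂vol a b) +
        ∫⁻ y, ENNReal.ofReal (|h y| ^ p / p) ∂vol a b := by
        have hm := (measurable_kernel_right s γ x).ennreal_ofReal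
        rw [lintegral_add_left (by fun_prop), lintegral_const_mul _ hm]
    _ ≤ _ := by
        gcongr
        exact lintegral_kernel_le s hγ hx

theorem exponent_pos_iff {α p : ℝ} (hp : 1 < p) :
    0 < (α - 1) * (p / (p - 1)) + 1 ↔ 1 < α * p := by
  have hp' : 0 < p - 1 := sub_pos.2 hp
  have : (α - 1) * (p / (p - 1)) + 1 = (α * p - 1) / (p - 1) := by
    field_simp
    ring
  rw [this, div_pos_iff_of_pos_right hp', sub_pos]

theorem greenIdentity_of_one_lt {s : Side} {a b α p : ℝ} (hab : a < b) (hα0 : 0 < α)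
    (hα1 : α < 1) (hp : 1 < p) (hαp : 1 < α * p) {u v : ℝ → ℝ} (hu : HasFracLaplacian s a b α p u)
    (hi : IntegrableOn (fracLaplacian s a b α p u) (Ioo a b))
    (hv : v ∈ fracSobolevRing s a b α p) : GreenIdentity s a b α p u v := by
  obtain ⟨h, hh, hmem, hvh⟩ := exists_fracInt_of_mem_fracSobolevRing hab hα0 hα1 hp hv
  have hγ := (exponent_pos_iff hp).2 hαp
  obtain ⟨C, hC, hC'⟩ := exists_lintegral_bound_of_memLp s hα0 (holderConjugate_div hp) hγ hmem
  exact greenIdentity_of_bound hab hα0 hα1 hu hi hh hvh hC hC'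
    ⟨_, hvh.symm, tendsto_fracInt_of_memLp hab hα0 (holderConjugate_div hp) hγ hmem⟩

/-! ### The case of a dual-integrable Laplacian, for all `αp`. -/

/-- Young's inequality is applied to `|g| |h|` with the kernel left as a weight, so only its first
power is integrated and no condition on `αp` arises. -/
theorem kernelIntegrable_of_memLp {s : Side} {a b α p q : ℝ} (hα0 : 0 < α)
    (hpq : q.HolderConjugate p) {g h : ℝ → ℝ} (hg : MemLp g (ENNReal.ofReal q) (vol a b))
    (hh : MemLp h (ENNReal.ofReal p) (vol a b)) : KernelIntegrable s a b α g h := by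
  have k1 : KernelIntegrable s a b α (fun _ => 1) (fun y => |h y| ^ p / p) :=
    kernelIntegrable_one hα0 ((integrable_abs_rpow hpq.symm.pos hh).div_const p)
  have k2 : KernelIntegrable s a b α (fun x => |g x| ^ q / q) (fun _ => 1) := by
    simpa only [Side.opp_opp] using (kernelIntegrable_one (s := s.opp) hα0
      ((integrable_abs_rpow hpq.pos hg).div_const q)).swap
  refine Integrable.mono' (Integrable.add k1 k2) ?_ (Eventually.of_forall fun z => ?_)
  · exact (hg.1.comp_fst.mul (measurable_kernel s α).aestronglyMeasurable).mul hh.1.comp_snd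
  · have hy := Real.young_inequality_of_nonneg (abs_nonneg (g z.1)) (abs_nonneg (h z.2)) hpq
    have hk := kernel_nonneg s hα0 z.1 z.2
    simp only [norm_mul, Real.norm_eq_abs, abs_of_nonneg hk, Pi.add_apply, one_mul, mul_one]
    calc _ = kernel s α z.1 z.2 * (|g z.1| * |h z.2|) := by ring
      _ ≤ kernel s α z.1 z.2 * (|g z.1| ^ q / q + |h z.2| ^ p / p) := by gcongr
      _ = _ := by ring

/-- Hölder's inequality after splitting the kernel as `k^(1/p) · k^(1/q)`, that is, Jensen's
inequality for the finite measure with density `k`. -/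
theorem lintegral_kernel_mul_rpow_le (s : Side) {a b α p q x : ℝ} (hα0 : 0 < α)
    (hpq : q.HolderConjugate p) (hx : x ∈ Icc a b) {g : ℝ → ℝ}
    (hg : AEStronglyMeasurable g (vol a b)) :
    (∫⁻ y, ENNReal.ofReal (kernel s α x y) * ‖g y‖ₑ ∂vol a b) ^ q ≤
      ENNReal.ofReal ((Real.Gamma α)⁻¹ * ((b - a) ^ α / α)) ^ (q / p) *
        ∫⁻ y, ENNReal.ofReal (kernel s α x y) * ‖g y‖ₑ ^ q ∂vol a b := by
  have hq := hpq.pos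
  have hp := hpq.symm.pos
  have hm : AEMeasurable (fun y => ENNReal.ofReal (kernel s α x y)) (vol a b) :=
    (measurable_kernel_right s α x).ennreal_ofReal.aemeasurable
  have H := ENNReal.lintegral_mul_le_Lp_mul_Lq (vol a b) hpq.symm
    (f := fun y => ENNReal.ofReal (kernel s α x y) ^ (1 / p))
    (g := fun y => ENNReal.ofReal (kernel s α x y) ^ (1 / q) * ‖g y‖ₑ)
    (hm.pow_const _) ((hm.pow_const _).mul hg.enorm)
  have e : ∀ y, ENNReal.ofReal (kernel s α x y) ^ (1 / p) *
      (ENNReal.ofReal (kernel s α x y) ^ (1 / q) * ‖g y‖ₑ) =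
      ENNReal.ofReal (kernel s α x y) * ‖g y‖ₑ := fun y => by
    rw [← mul_assoc, ← ENNReal.rpow_add_of_nonneg _ _ (by positivity) (by positivity), one_div,
      one_div, hpq.symm.inv_add_inv_eq_one, ENNReal.rpow_one]
  simp only [Pi.mul_apply, e, ENNReal.mul_rpow_of_nonneg _ _ hq.le, ← ENNReal.rpow_mul,
    one_div_mul_cancel hq.ne', one_div_mul_cancel hp.ne', ENNReal.rpow_one] at H
  refine (ENNReal.rpow_le_rpow H hq.le).trans ?_
  rw [ENNReal.mul_rpow_of_nonneg _ _ hq.le, ← ENNReal.rpow_mul, ← ENNReal.rpow_mul,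
    one_div_mul_cancel hq.ne', ENNReal.rpow_one, one_div_mul_eq_div]
  gcongr
  exact lintegral_kernel_le s hα0 hx

/-- Fractional integration maps `L^q` to itself. -/
theorem memLp_fracInt (s : Side) {a b α p q : ℝ} (hα0 : 0 < α) (hpq : q.HolderConjugate p)
    {g : ℝ → ℝ} (hg : MemLp g (ENNReal.ofReal q) (vol a b)) :
    MemLp (fracInt s a b α g) (ENNReal.ofReal q) (vol a b) := by
  have hq := hpq.pos
  have hgi : Integrable g (vol a b) :=
    hg.integrable (by rw [← ENNReal.ofReal_one]; exact ENNReal.ofReal_le_ofReal hpq.lt.le)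
  have k : KernelIntegrable s a b α (fun _ => 1) (fun y => |g y| ^ q) :=
    kernelIntegrable_one hα0 (integrable_abs_rpow hq hg)
  have hfin : ∫⁻ x, ∫⁻ y, ENNReal.ofReal (kernel s α x y) * ‖g y‖ₑ ^ q ∂vol a b ∂vol a b < ⊤ := by
    have := k.2
    rw [HasFiniteIntegral, lintegral_prod _ k.1.enorm] at this
    simpa only [one_mul, enorm_mul, enorm_kernel s hα0, Real.enorm_rpow_of_nonneg (abs_nonneg _) hq.le,
      Real.enorm_abs] using this
  refine ⟨(integrable_fracInt s hα0 hgi).1, ?_⟩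
  rw [eLpNorm_lt_top_iff_lintegral_rpow_enorm_lt_top (by simpa using hq) ENNReal.ofReal_ne_top,
    ENNReal.toReal_ofReal hq.le]
  have hpos := hpq.symm.pos
  calc _ ≤ ∫⁻ x, ENNReal.ofReal ((Real.Gamma α)⁻¹ * ((b - a) ^ α / α)) ^ (q / p) *
        ∫⁻ y, ENNReal.ofReal (kernel s α x y) * ‖g y‖ₑ ^ q ∂vol a b ∂vol a b := by
        refine lintegral_mono_ae ?_
        filter_upwards [ae_mem_Ioo a b] with x hx
        have hx := Ioo_subset_Icc_self hx
        exact (ENNReal.rpow_le_rpow (enorm_fracInt_le s hα0 hx g) hq.le).trans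
          (lintegral_kernel_mul_rpow_le s hα0 hpq hx hg.1)
    _ = ENNReal.ofReal ((Real.Gamma α)⁻¹ * ((b - a) ^ α / α)) ^ (q / p) *
        ∫⁻ x, ∫⁻ y, ENNReal.ofReal (kernel s α x y) * ‖g y‖ₑ ^ q ∂vol a b ∂vol a b :=
        lintegral_const_mul' _ _ (by finiteness)
    _ < ⊤ := ENNReal.mul_lt_top (by finiteness) hfin

/-- The `q`-th power of the kernel is a multiple of `t ^ ((α - 1) * q)` in the distance `t` to the
base point, integrable near `0` only if the exponent exceeds `-1`. -/
theorem exponent_pos_of_memLp_kernel {s : Side} {a b α q : ℝ} (hab : a < b) (hα0 : 0 < α)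
    (hq : 0 < q)
    (h : MemLp (fun x => kernel s α x (s.base a b)) (ENNReal.ofReal q) (vol a b)) :
    0 < (α - 1) * q + 1 := by
  have hG := Real.Gamma_pos_of_pos hα0
  have h1 : IntegrableOn (fun x => |kernel s α x (s.base a b)| ^ q) (Ioo a b) :=
    integrable_abs_rpow hq h
  have key : ∀ f : ℝ → ℝ, MeasurePreserving f volume volume → MeasurableEmbedding f →
      f ⁻¹' Ioo 0 (b - a) = Ioo a b →
      (∀ x, kernel s α x (s.base a b) = rieszKernel α (f x)) → 0 < (α - 1) * q + 1 := by
    intro f hf hf' hpre hk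
    have h2 : IntegrableOn ((fun t => |rieszKernel α t| ^ q) ∘ f) (f ⁻¹' Ioo 0 (b - a)) := by
      rw [hpre]
      simpa only [hk, Function.comp_def] using h1
    rw [hf.integrableOn_comp_preimage hf'] at h2
    have h3 : IntegrableOn (fun t : ℝ => t ^ ((α - 1) * q)) (Ioo 0 (b - a)) := by
      refine IntegrableOn.congr_fun (h2.const_mul (((Real.Gamma α)⁻¹ ^ q)⁻¹)) (fun t ht => ?_)
        measurableSet_Ioo
      have ht0 := ht.1
      have hG' : (Real.Gamma α)⁻¹ ^ q ≠ 0 := by positivity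
      simp only [rieszKernel, if_pos ht0]
      rw [abs_of_nonneg (by positivity), Real.mul_rpow (by positivity) (by positivity),
        ← Real.rpow_mul ht0.le, inv_mul_cancel_left₀ hG']
    rw [intervalIntegral.integrableOn_Ioo_rpow_iff (sub_pos.2 hab)] at h3
    linarith
  cases s
  · refine key (fun x => x - a) (measurePreserving_sub_right volume a)
      (MeasurableEquiv.subRight a).measurableEmbedding ?_ fun x => rfl
    ext x
    simp
  · refine key (fun x => b - x) (Measure.measurePreserving_sub_left volume b)
      (MeasurableEquiv.subLeft b).measurableEmbedding ?_ fun x => rfl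
    ext x
    simp

theorem abs_flux (s : Side) {a b α p : ℝ} (hp : 1 < p) (u : ℝ → ℝ) (x : ℝ) :
    |flux s a b α p u x| = |weakFracDeriv s a b α u x| ^ (p - 1) := by
  rw [flux, abs_mul, abs_of_nonneg (by positivity)]
  -- Zero is separate since `p - 2` may be negative; there the second factor of the flux vanishes.
  rcases (abs_nonneg (weakFracDeriv s a b α u x)).eq_or_lt with h | h
  · rw [← h, mul_zero, Real.zero_rpow (by linarith)]
  · rw [← Real.rpow_add_one h.ne']
    congr 1
    ring

theorem memLp_flux {s : Side} {a b α p : ℝ} (hp : 1 < p) {u : ℝ → ℝ}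
    (hu : u ∈ fracSobolev s a b α p)
    (hm : AEStronglyMeasurable (flux s a b α p u) (vol a b)) :
    MemLp (flux s a b α p u) (ENNReal.ofReal (p / (p - 1))) (vol a b) := by
  have hp' : 0 < p - 1 := sub_pos.2 hp
  have h := hu.2.2.norm_rpow_div (ENNReal.ofReal (p - 1))
  rw [← ENNReal.ofReal_div_of_pos hp', ENNReal.toReal_ofReal hp'.le] at h
  refine h.of_le hm (Eventually.of_forall fun x => ?_)
  rw [Real.norm_eq_abs, abs_flux s hp, Real.norm_of_nonneg (by positivity), Real.norm_eq_abs]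

theorem greenIdentity_of_memLp {s : Side} {a b α p : ℝ} (hab : a < b) (hα0 : 0 < α)
    (hα1 : α < 1) (hp : 1 < p) {u v : ℝ → ℝ} (hus : u ∈ fracSobolev s a b α p)
    (hu : HasFracLaplacian s a b α p u)
    (hi : IntegrableOn (fracLaplacian s a b α p u) (Ioo a b))
    (hi' : MemLp (fracLaplacian s a b α p u) (ENNReal.ofReal (p / (p - 1))) (vol a b))
    (hv : v ∈ fracSobolevRing s a b α p) (ht : ∃ t, HasTrace s a b v t) :
    GreenIdentity s a b α p u v := by
  by_cases hαp : 1 < α * p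
  · exact greenIdentity_of_one_lt hab hα0 hα1 hp hαp hu hi hv
  obtain ⟨h, hh, hmem, hvh⟩ := exists_fracInt_of_mem_fracSobolevRing hab hα0 hα1 hp hv
  obtain ⟨t, ht⟩ := ht
  obtain ⟨n, hw, hn⟩ := hu.exists_flux_ae_eq hab hα0 hα1 hi
  have hpq := holderConjugate_div hp
  have hfl : Integrable (flux s a b α p u) (vol a b) := (isWeakFracDeriv_weakFracDeriv hu).1
  -- Both the flux and the fractional integral of the Laplacian lie in `L^(p/(p-1))`, hence so does
  -- `n` times the kernel; `n ≠ 0` would force `αp > 1`.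
  have hn0 : n = 0 := by
    by_contra hne
    refine hαp ((exponent_pos_iff hp).1 (exponent_pos_of_memLp_kernel (s := s.opp) hab hα0 hpq.pos ?_))
    have hsub := ((memLp_flux hp hus hfl.1).sub (memLp_fracInt s.opp hα0 hpq hi')).const_mul n⁻¹
    refine hsub.ae_eq ?_
    filter_upwards [hw] with x hx
    simp only [Pi.sub_apply]
    rw [hx, add_sub_cancel_right, inv_mul_cancel_left₀ hne]
  subst hn0
  exact greenIdentity_of_ae_eq hα0 hα1 hw hn hh hvh (kernelIntegrable_of_memLp hα0 hpq hi' hmem) ht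
    (by simp) (by simp)

/-! ### The natural boundary condition. -/

theorem isWeakFracDeriv_zero (s : Side) (a b α : ℝ) : IsWeakFracDeriv s a b α 0 0 :=
  ⟨integrableOn_zero, IntegrableOn.locallyIntegrableOn integrableOn_zero, fun φ _ => by simp⟩

theorem weakFracDeriv_zero (s : Side) (a b α : ℝ) : weakFracDeriv s a b α 0 =ᵐ[vol a b] 0 :=
  (isWeakFracDeriv_weakFracDeriv ⟨0, isWeakFracDeriv_zero s a b α⟩).ae_eq
    (isWeakFracDeriv_zero s a b α)

theorem zero_mem_fracSobolev (s : Side) (a b α p : ℝ) : 0 ∈ fracSobolev s a b α p :=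
  ⟨MemLp.zero, ⟨0, isWeakFracDeriv_zero s a b α⟩,
    MemLp.zero.ae_eq (weakFracDeriv_zero s a b α).symm⟩

theorem energy_zero (s : Side) (a b α : ℝ) {p : ℝ} (hp : 0 < p) : energy s a b α p 0 = 0 := by
  have : ∫ x, |weakFracDeriv s a b α 0 x| ^ p ∂vol a b = 0 := by
    refine integral_eq_zero_of_ae ?_
    filter_upwards [weakFracDeriv_zero s a b α] with x hx
    simp [hx, hp.ne']
  rw [energy]
  exact mul_eq_zero_of_right _ this

/-- No first variation is needed: `0` is a competitor of energy zero, so the derivative of a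
minimizer, and with it the flux, vanishes almost everywhere. -/
theorem hasNeumann_zero_of_isMinOn {s : Side} {a b α p : ℝ} (hp : 1 < p)
    {u : ℝ → ℝ} (hu : u ∈ fracSobolev s a b α p)
    (hmin : IsMinOn (energy s a b α p) (fracSobolev s a b α p) u) :
    HasNeumann s a b α p u 0 := by
  have hp0 : 0 < p := one_pos.trans hp
  have hE : energy s a b α p u ≤ 0 := by
    simpa [energy_zero s a b α hp0] using hmin (zero_mem_fracSobolev s a b α p)
  have hI : ∫ x, |weakFracDeriv s a b α u x| ^ p ∂vol a b = 0 := by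
    refine le_antisymm ?_ (integral_nonneg fun x => by positivity)
    exact nonpos_of_mul_nonpos_right hE (inv_pos.2 hp0)
  rw [integral_eq_zero_iff_of_nonneg (fun x => by positivity)
    (integrable_abs_rpow hp0 hu.2.2)] at hI
  have hfl : flux s a b α p u =ᵐ[vol a b] 0 := by
    filter_upwards [hI] with x hx
    have : weakFracDeriv s a b α u x = 0 := by
      simpa [Real.rpow_eq_zero (abs_nonneg _) hp0.ne'] using hx
    simp [flux, this]
  refine ⟨0, ?_, tendsto_const_nhds⟩
  filter_upwards [ae_mem_Ioo a b] with x hx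
  have hx := Ioo_subset_Icc_self hx
  rw [fracInt_congr s.opp hx hfl, fracInt_eq _ _ _ hx]
  simp

end FracCalc

theorem mainTheorem5 (s : Side) (a b α p : ℝ) (hab : a < b) (hα0 : 0 < α) (hα1 : α < 1)
    (hp : 1 < p) :
    -- a minimizer over the whole space satisfies the natural boundary condition
    (∀ u ∈ fracSobolev s a b α p,
      IsMinOn (energy s a b α p) (fracSobolev s a b α p) u → HasNeumann s a b α p u 0) ∧
    -- Green's identity, when `u` has an integrable fractional `p`-Laplacian
    (∀ u ∈ fracSobolev s a b α p, HasFracLaplacian s a b α p u →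
      IntegrableOn (fracLaplacian s a b α p u) (Ioo a b) →
      -- `v` smooth up to the boundary
      (∀ v : ℝ → ℝ, ContDiffOn ℝ ∞ v (Icc a b) → GreenIdentity s a b α p u v) ∧
      -- `v` in the energy space without kernel component, traces being automatic for `α p > 1`
      (1 < α * p → ∀ v ∈ fracSobolevRing s a b α p, GreenIdentity s a b α p u v) ∧
      -- the same for all `α p`, for `v` that has a trace
      (MemLp (fracLaplacian s a b α p u) (ENNReal.ofReal (p / (p - 1))) (vol a b) →
        ∀ v ∈ fracSobolevRing s a b α p, (∃ t, HasTrace s a b v t) →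
          GreenIdentity s a b α p u v)) := by
  refine ⟨fun u hu hmin => hasNeumann_zero_of_isMinOn hp hu hmin, fun u hus hu hi =>
    ⟨fun v hv => greenIdentity_of_contDiffOn hab hα0 hα1 hu hi hv,
      fun hαp v hv => greenIdentity_of_one_lt hab hα0 hα1 hp hαp hu hi hv,
      fun hi' v hv ht => greenIdentity_of_memLp hab hα0 hα1 hp hus hu hi hi' hv ht⟩⟩
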